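/- Let $n\ge 1$ and let $E^n$ be Euclidean space with orthonormal basis $e_1,\dots,e_n$. Let $Cl_{n-1}$ be the real Clifford algebra generated by $E^{n-1}=\mathrm{span}(e_2,\dots,e_n)$ with relations $uv+vu=-2(u,v)$, and identify $E^n$ with $\mathbb R\oplus E^{n-1}\subset Cl_{n-1}$, $e_1$ becoming $1$; elements of this subspace are called vectors. Let $a\mapsto a'$ be the automorphism of $Cl_{n-1}$ with $e_j'=-e_j$, $a\mapsto a^*$ the anti-automorphism with $e_j^*=e_j$ ($2\le j\le n$), and $|\cdot|$ the norm of the inner product of $Cl_{n-1}$ for which the products $e_{i_1}\cdots e_{i_r}$, $2\le i_1<\dots<i_r\le n$, are orthonormal. Let $\Gamma_n$ be the set of finite products of nonzero vectors. The Vahlen group $\widetilde G=SL_2(\Gamma_n)$ consists of the matrices $g=\begin{pmatrix}a&b\\c&d\end{pmatrix}$ with $a,b,c,d\in\Gamma_n\cup\{0\}$, $ad^*-bc^*=1$, $ab^*\in E^n$ and $cd^*\in E^n$. Let $\Sigma$ be a Clifford module, that is, a finite-dimensional complex Hilbert space with skew-Hermitian operators $E_1,\dots,E_n$ such that $E_iE_j+E_jE_i=-2\delta_{ij}\,\mathrm{Id}$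 (for instance the spinor representation $\Sigma_n$). Let $\tau:Cl_{n-1}\to\mathrm{End}(\Sigma)$ be the algebra representation with $\tau(e_j)=E_1E_j$ for $2\le j\le n$, and put $\tau'(a)=\tau(a')$. For $\lambda\in\mathbb C$, $g\in\widetilde G$ as above and $f:E^n\to\Sigma$ set \[ \pi'_\lambda(g)f(x)=|u|^{-2\lambda-n}\,\tau'\Big(\frac{u}{|u|}\Big)^{-1}f\big((-c^*+a^*x)\,u^{-1}\big),\qquad u=d^*-b^*x, \] for all $x\in E^n$ with $u\ne 0$; at the point (there is at most one) where $u=0$, $\pi'_\lambda(g)f$ is extended by continuity whenever this is possible. Let $\mathcal H_\lambda$ be the space of all smooth $f:E^n\to\Sigma$ such that $\pi'_\lambda(g)f$ is smooth on all of $E^n$ for every $g\in\widetilde G$ (the smooth vectors of the principal series representation $\pi'_\lambda$ in the noncompact picture). Let $Df=\sum_{j=1}^nE_j\,\partial f/\partial x_j$ be the Dirac operator. Then, for every integer $k\ge 0$ and every $g\in\widetilde G$: (i) $D^{2k+1}$ maps $\mathcal H_{-k-1/2}$ into $\mathcal H_{k+1/2}$, and on $\mathcal H_{-k-1/2}$ \[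 D^{2k+1}\circ\pi'_{-k-\frac12}(g)=\pi'_{k+\frac12}(g)\circ D^{2k+1}. \] (ii) The same identity holds locally: if $f:E^n\to\Sigma$ is smooth on an open set $U\subset E^n$, then \[ D^{2k+1}\big(\pi'_{-k-\frac12}(g)f\big)(x)=\big(\pi'_{k+\frac12}(g)\,D^{2k+1}f\big)(x) \] at every $x\in E^n$ with $u=d^*-b^*x\neq0$ and $(-c^*+a^*x)u^{-1}\in U$. -/

import Mathlib

open scoped ContDiff Topology

noncomputable section

namespace Vahlen

/-! Throughout `n = m + 1`: the Clifford algebra `Cl m` is `Cl(E^{n-1})`, generated by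
`e_2, …, e_n`, and `Vec m` is `E^n`, whose coordinate of index `0` belongs to `e_1`. -/

/-- The Euclidean space `E^n`, with `n = m + 1`. -/
abbrev Vec (m : ℕ) : Type := EuclideanSpace ℝ (Fin (m + 1))

/-- The negative definite quadratic form `v ↦ -|v|²` on `E^{n-1}`. -/
def negSq (m : ℕ) : QuadraticForm ℝ (Fin m → ℝ) :=
  QuadraticMap.weightedSumSquares ℝ (fun _ : Fin m => (-1 : ℝ))

theorem negSq_apply (m : ℕ) (v : Fin m → ℝ) : negSq m v = -∑ j, v j * v j := by
  simp [negSq, QuadraticMap.weightedSumSquares_apply]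

/-- The real Clifford algebra of `E^{n-1}`, with relations `u v + v u = -2 (u, v)`. -/
abbrev Cl (m : ℕ) : Type := CliffordAlgebra (negSq m)

/-- The principal automorphism `a ↦ a'`. -/
abbrev prime {m : ℕ} (a : Cl m) : Cl m := CliffordAlgebra.involute a

/-- The reversion `a ↦ a^*`. -/
abbrev rev {m : ℕ} (a : Cl m) : Cl m := CliffordAlgebra.reverse a

/-- The conjugation `a ↦ ā`, the composition of the two other involutions. -/
abbrev conj {m : ℕ} (a : Cl m) : Cl m := rev (prime a)

/-- The identification of `E^n` with the subspace `ℝ ⊕ E^{n-1}` of the Clifford algebra: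
`(x_1, …, x_n) ↦ x_1 + x_2 e_2 + ⋯ + x_n e_n`. -/
def vec {m : ℕ} (x : Vec m) : Cl m :=
  algebraMap ℝ (Cl m) (x 0) + CliffordAlgebra.ι (negSq m) (fun j : Fin m => x j.succ)

/-- The inverse of the identification `vec` (arbitrary outside of its range). -/
def ofVec {m : ℕ} (a : Cl m) : Vec m := Function.invFun vec a

/-- The scalar part: the coefficient of `1` in the basis of the products `e_{i_1} ⋯ e_{i_r}`,
`i_1 < ⋯ < i_r`, which `equivExterior` sends to `e_{i_1} ∧ ⋯ ∧ e_{i_r}`. -/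
def scalarPart {m : ℕ} (a : Cl m) : ℝ :=
  ExteriorAlgebra.algebraMapInv (CliffordAlgebra.equivExterior (negSq m) a)

/-- The norm of the canonical inner product `(a, b) ↦ scalarPart (a b̄)` on `Cl(E^{n-1})`,
for which the products `e_{i_1} ⋯ e_{i_r}`, `i_1 < ⋯ < i_r`, are orthonormal. -/
def cnorm {m : ℕ} (a : Cl m) : ℝ := Real.sqrt (scalarPart (a * conj a))

/-- The Clifford group `Γ_n`: all finite products of nonzero vectors. -/
def Gam (m : ℕ) : Submonoid (Cl m) :=
  Submonoid.closure {a | ∃ x : Vec m, x ≠ 0 ∧ a = vec x}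

/-- The Vahlen group `SL_2(Γ_n)`: the set of Clifford matrices. -/
def SL2Gam (m : ℕ) : Set (Matrix (Fin 2) (Fin 2) (Cl m)) :=
  {g | (∀ i j, g i j ∈ Gam m ∨ g i j = 0) ∧
    g 0 0 * rev (g 1 1) - g 0 1 * rev (g 1 0) = 1 ∧
    g 0 0 * rev (g 0 1) ∈ Set.range (vec (m := m)) ∧
    g 1 0 * rev (g 1 1) ∈ Set.range (vec (m := m))}

/-- `d^* - b^* x`. -/
def den {m : ℕ} (g : Matrix (Fin 2) (Fin 2) (Cl m)) (x : Vec m) : Cl m :=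
  rev (g 1 1) - rev (g 0 1) * vec x

/-- `(-c^* + a^* x)(d^* - b^* x)^{-1}`, an element of `E^n` whenever `d^* - b^* x ≠ 0`. -/
def act {m : ℕ} (g : Matrix (Fin 2) (Fin 2) (Cl m)) (x : Vec m) : Vec m :=
  ofVec ((-rev (g 1 0) + rev (g 0 0) * vec x) * Ring.inverse (den g x))

/-- A Clifford module: skew-Hermitian operators `E_1, …, E_n` on a finite dimensional complex
Hilbert space with `E_i E_j + E_j E_i = -2 δ_ij Id`. -/
structure CliffordModule (m : ℕ) (S : Type*) [NormedAddCommGroup S] [InnerProductSpace ℂ S]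
    [FiniteDimensional ℂ S] where
  E : Fin (m + 1) → Module.End ℂ S
  skew : ∀ j v w, inner ℂ (E j v) w = -inner ℂ v (E j w)
  rel : ∀ i j, E i * E j + E j * E i = if i = j then (-2 : ℂ) • 1 else 0

section Representation

variable {m : ℕ} {S : Type*} [NormedAddCommGroup S] [InnerProductSpace ℂ S]
  [FiniteDimensional ℂ S] (M : CliffordModule m S)

/-- The linear map `E^{n-1} → End(S)`, `e_j ↦ E_1 E_j`. -/
def tauLin : (Fin m → ℝ) →ₗ[ℝ] Module.End ℂ S where
  toFun v := ∑ j, v j • (M.E 0 * M.E j.succ)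
  map_add' v w := by simp [add_smul, Finset.sum_add_distrib]
  map_smul' r v := by simp [mul_smul, Finset.smul_sum]

theorem tauLin_sq (v : Fin m → ℝ) :
    tauLin M v * tauLin M v = algebraMap ℝ (Module.End ℂ S) (negSq m v) := by
  have hE : ∀ i, M.E i * M.E i = -1 := by
    intro i
    have h := M.rel i i
    rw [if_pos rfl] at h
    have h2 : (2 : ℂ) • (M.E i * M.E i) = (2 : ℂ) • (-1 : Module.End ℂ S) := by
      rw [two_smul, h]; module
    exact smul_right_injective _ (two_ne_zero' ℂ) h2
  have hA : ∀ i j, i ≠ j → M.E j * M.E i = -(M.E i * M.E j) := by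
    intro i j hij
    have h := M.rel i j
    rw [if_neg hij] at h
    exact (neg_eq_of_add_eq_zero_right h).symm
  have hP : ∀ i j : Fin m, (M.E 0 * M.E i.succ) * (M.E 0 * M.E j.succ) =
      M.E i.succ * M.E j.succ := by
    intro i j
    calc (M.E 0 * M.E i.succ) * (M.E 0 * M.E j.succ)
        = M.E 0 * (M.E i.succ * M.E 0) * M.E j.succ := by simp only [mul_assoc]
      _ = -((M.E 0 * M.E 0) * (M.E i.succ * M.E j.succ)) := by
          rw [hA 0 i.succ (Fin.succ_ne_zero i).symm]; simp only [mul_assoc, mul_neg, neg_mul]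
      _ = M.E i.succ * M.E j.succ := by rw [hE]; simp
  have hT : tauLin M v * tauLin M v =
      ∑ i, ∑ j, (v i * v j) • (M.E i.succ * M.E j.succ) := by
    simp only [tauLin, LinearMap.coe_mk, AddHom.coe_mk, Finset.sum_mul_sum, smul_mul_smul_comm, hP]
  have hT2 : (2 : ℝ) • (tauLin M v * tauLin M v) =
      (2 : ℝ) • algebraMap ℝ (Module.End ℂ S) (negSq m v) := by
    have hs : ∑ i, ∑ j, (v i * v j) • (M.E i.succ * M.E j.succ) =
        ∑ i, ∑ j, (v i * v j) • (M.E j.succ * M.E i.succ) := by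
      rw [Finset.sum_comm]
      simp only [mul_comm (v _) (v _)]
    rw [two_smul, hT]
    nth_rewrite 2 [hs]
    simp only [← Finset.sum_add_distrib, ← smul_add]
    have hd : ∀ i j : Fin m, (v i * v j) • (M.E i.succ * M.E j.succ + M.E j.succ * M.E i.succ) =
        if i = j then (v i * v j) • ((-2 : ℝ) • (1 : Module.End ℂ S)) else 0 := by
      intro i j
      by_cases hij : i = j
      · subst hij
        rw [hE, if_pos rfl]; module
      · rw [hA i.succ j.succ (fun h => hij (Fin.succ_injective _ h)), if_neg hij]
        simp
    simp only [hd, Finset.sum_ite_eq, Finset.mem_univ, if_true]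
    rw [negSq_apply, Algebra.algebraMap_eq_smul_one, ← Finset.sum_smul]
    module
  exact smul_right_injective _ (two_ne_zero' ℝ) hT2

/-- The representation `τ` of `Cl(E^{n-1})` with `τ(e_j) = E_1 E_j` for `2 ≤ j ≤ n`. -/
def tau : Cl m →ₐ[ℝ] Module.End ℂ S :=
  CliffordAlgebra.lift (negSq m) ⟨tauLin M, tauLin_sq M⟩

/-- The representation `τ'(a) = τ(a')`. -/
def tau' (a : Cl m) : Module.End ℂ S := tau M (prime a)

/-- The expression `|u|^{-2λ-n} τ'(u/|u|)^{-1} f((-c^* + a^* x) u^{-1})`, `u = d^* - b^* x`. -/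
def piFormula (l : ℂ) (g : Matrix (Fin 2) (Fin 2) (Cl m)) (f : Vec m → S) (x : Vec m) : S :=
  ((cnorm (den g x) : ℂ) ^ (-2 * l - ((m + 1 : ℕ) : ℂ))) •
    Ring.inverse (tau' M ((cnorm (den g x))⁻¹ • den g x)) (f (act g x))

open Classical in
/-- The representation `π'_λ` in the noncompact picture. At the point (at most one) with
`d^* - b^* x = 0`, the function is extended by continuity. -/
def piPrime (l : ℂ) (g : Matrix (Fin 2) (Fin 2) (Cl m)) (f : Vec m → S) (x : Vec m) : S :=
  if den g x = 0 then Filter.limUnder (𝓝[≠] x) (piFormula M l g f) else piFormula M l g f x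

/-- The smooth vectors of `π'_λ` in the noncompact picture: the smooth functions on `E^n` all of
whose translates are smooth on `E^n`; these are the restrictions to `E^n` of the smooth sections
of the homogeneous bundle over the sphere. -/
def smoothVectors (l : ℂ) : Set (Vec m → S) :=
  {f | ContDiff ℝ ∞ f ∧ ∀ g ∈ SL2Gam m, ContDiff ℝ ∞ (piPrime M l g f)}

/-- The Dirac operator `D f = ∑ E_j ∂f/∂x_j`. -/
def dirac (f : Vec m → S) (x : Vec m) : S :=
  ∑ j, M.E j (fderiv ℝ f x (EuclideanSpace.single j 1))

end Representation

end Vahlen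

end

/-! Write n = m + 1, c(x) = ∑ x_j E_j, and let E be the Euler operator. The Lean index 0 is the
index 1 of the text, so `M.E 0` is E_1. Each g acts as a similarity if b = 0, and as a translation
followed by the inversion x ↦ x/|x|² and a similarity if b ≠ 0. Correspondingly, π'_λ(g) is a
composition of elementary operators, and it suffices to know how D behaves under each of them.

Translations commute with D. For a linear similarity L of ratio ρ and an endomorphism T with c(y)T =
μ T c(Ly), the chain rule and the independence of D of the orthonormal basis give D(T f(L· + w)) =
μρ² T (Df)(L· + w) (`dirac_comp_similarity`). The core is the Kelvin transform K_p h(x) = |x|^{2p}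
c(x) h(x/|x|²): D^{2k+1} K_{k-n/2} = -K_{-k-1-n/2} D^{2k+1} (`dirac_iterate_kelvin`). This goes by
induction on k. Since K_{p+1} = |x|² K_p, the relations [D, E] = D and [D², |x|²] = -4(E + n/2)
reduce the step to a second order identity (`kelvin_step`).

The Clifford algebra supplies the normal forms `piPrime_of_b_eq_zero` and `piFormula_of_b_ne_zero`,
where ρ = β^{-2} and μ = ±β². The factor (μρ²)^{2k+1} then accounts exactly for the change of the
power of |u| between λ = -k-1/2 and λ = k+1/2, and for b ≠ 0 its sign cancels that of the Kelvin
identity. Functions smooth only on U are handled by a cutoff, and the point u = 0 by continuity. -/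

namespace Vahlen

/-! ### Clifford multiplication and the symbol of the Dirac operator -/

section Analysis

variable {m : ℕ} {S : Type*} [NormedAddCommGroup S] [InnerProductSpace ℂ S]
  [FiniteDimensional ℂ S] (M : CliffordModule m S)

/-- Clifford multiplication `x ↦ ∑ x_j E_j` on the module. -/
noncomputable def cmul : Vec m →L[ℝ] S →L[ℝ] S :=
  ∑ j, (EuclideanSpace.proj j : Vec m →L[ℝ] ℝ).smulRight
    ((LinearMap.toContinuousLinearMap (M.E j)).restrictScalars ℝ)

theorem cmul_apply (x : Vec m) (v : S) : cmul M x v = ∑ j, x j • M.E j v := by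
  simp [cmul]

theorem cmul_single (j : Fin (m + 1)) (v : S) :
    cmul M (EuclideanSpace.single j 1) v = M.E j v := by
  simp [cmul_apply]

theorem E_E_add (i j : Fin (m + 1)) (v : S) :
    M.E i (M.E j v) + M.E j (M.E i v) = if i = j then (-2 : ℝ) • v else 0 := by
  have h := LinearMap.congr_fun (M.rel i j) v
  simp only [LinearMap.add_apply, Module.End.mul_apply] at h
  rw [h]
  split_ifs
  · rw [LinearMap.smul_apply, Module.End.one_apply]
    have : (-2 : ℂ) = ((-2 : ℝ) : ℂ) := by norm_num
    rw [this, Complex.coe_smul]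
  · simp

theorem cmul_cmul_add (x y : Vec m) (v : S) :
    cmul M x (cmul M y v) + cmul M y (cmul M x v) = (-2 * inner ℝ x y) • v := by
  have h1 : ∀ x y : Vec m,
      cmul M x (cmul M y v) = ∑ i, ∑ j, (x i * y j) • M.E i (M.E j v) := by
    intro x y
    simp only [cmul_apply, map_sum, mul_smul, LinearMap.map_smul_of_tower]
    rw [Finset.sum_comm]
  have h2 : cmul M y (cmul M x v) = ∑ i, ∑ j, (x i * y j) • M.E j (M.E i v) := by
    rw [Finset.sum_comm, h1]
    simp only [mul_comm (x _) (y _)]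
  rw [h1 x y, h2]
  simp only [← Finset.sum_add_distrib, ← smul_add, E_E_add, smul_ite, smul_zero,
    Finset.sum_ite_eq, Finset.mem_univ, if_true, ← Finset.sum_smul, smul_smul]
  rw [← Finset.sum_mul, PiLp.inner_apply]
  congr 1
  rw [mul_comm]
  simp [mul_comm]

theorem cmul_cmul (x : Vec m) (v : S) : cmul M x (cmul M x v) = (-‖x‖ ^ 2) • v := by
  have h := cmul_cmul_add M x x v
  rw [← two_smul ℝ, real_inner_self_eq_norm_sq] at h
  have h2 : (2 : ℝ) • cmul M x (cmul M x v) = (2 : ℝ) • ((-‖x‖ ^ 2) • v) := by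
    rw [h, smul_smul]; ring_nf
  exact smul_right_injective _ (two_ne_zero' ℝ) h2

/-- The symbol of the Dirac operator. -/
noncomputable def diracSymbol : (Vec m →L[ℝ] S) →ₗ[ℝ] S where
  toFun A := ∑ j, M.E j (A (EuclideanSpace.single j 1))
  map_add' A B := by simp [Finset.sum_add_distrib]
  map_smul' r A := by
    simp [Finset.smul_sum, LinearMap.map_smul_of_tower]

theorem diracSymbol_apply (A : Vec m →L[ℝ] S) :
    diracSymbol M A = ∑ j, cmul M (EuclideanSpace.single j 1) (A (EuclideanSpace.single j 1)) := by
  simp [diracSymbol, cmul_single]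

theorem dirac_eq {f : Vec m → S} {f' : Vec m →L[ℝ] S} {x : Vec m} (h : HasFDerivAt f f' x) :
    dirac M f x = diracSymbol M f' := by
  simp [dirac, diracSymbol, h.fderiv]

theorem sum_single (x : Vec m) : ∑ j, x j • (EuclideanSpace.single j 1 : Vec m) = x := by
  ext i
  simp [Pi.single_apply]

theorem inner_single_right (x : Vec m) (j : Fin (m + 1)) :
    inner ℝ x (EuclideanSpace.single j 1 : Vec m) = x j := by
  simp [PiLp.inner_apply, PiLp.single_apply]

theorem diracSymbol_smulRight (x : Vec m) (v : S) :
    diracSymbol M ((innerSL ℝ x).smulRight v) = cmul M x v := by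
  rw [diracSymbol_apply, cmul_apply]
  refine Finset.sum_congr rfl fun j _ => ?_
  rw [ContinuousLinearMap.smulRight_apply, innerSL_apply_apply, inner_single_right, map_smul,
    cmul_single]

/-- Anticommuting c(e_j) past c(x) leaves -2 x_j, and these remainders add up to -2 A x. With A = df
this is the source of the Euler operator. -/
theorem diracSymbol_cmul_comp (x : Vec m) (A : Vec m →L[ℝ] S) :
    diracSymbol M ((cmul M x).comp A) = -cmul M x (diracSymbol M A) - (2 : ℝ) • A x := by
  have h : ∀ j, cmul M (EuclideanSpace.single j 1) (cmul M x (A (EuclideanSpace.single j 1))) =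
      -cmul M x (cmul M (EuclideanSpace.single j 1) (A (EuclideanSpace.single j 1)))
        - (2 : ℝ) • (x j • A (EuclideanSpace.single j 1)) := by
    intro j
    have := cmul_cmul_add M (EuclideanSpace.single j 1) x (A (EuclideanSpace.single j 1))
    rw [real_inner_comm, inner_single_right] at this
    rw [eq_sub_of_add_eq this]
    module
  rw [diracSymbol_apply, diracSymbol_apply]
  simp only [ContinuousLinearMap.comp_apply, h, Finset.sum_sub_distrib, Finset.sum_neg_distrib,
    ← Finset.smul_sum, map_sum]
  congr 2
  conv_rhs => rw [← sum_single x]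
  simp

theorem diracSymbol_flip_cmul (v : S) :
    diracSymbol M ((cmul M).flip v) = (-((m : ℝ) + 1)) • v := by
  rw [diracSymbol_apply]
  simp only [ContinuousLinearMap.flip_apply, cmul_cmul]
  simp [Finset.sum_const, ← Nat.cast_smul_eq_nsmul ℝ]
  module

/-- A conformal linear map acts on the symbol by a scalar. -/
theorem diracSymbol_comp_conformal {L : Vec m →ₗ[ℝ] Vec m} {ρ : ℝ} (hρ : 0 < ρ)
    (hL : ∀ y, ‖L y‖ = ρ * ‖y‖) (A : Vec m →ₗ[ℝ] S) :
    ∑ j, cmul M (L (EuclideanSpace.single j 1)) (A (L (EuclideanSpace.single j 1))) =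
      ρ ^ 2 • ∑ j, cmul M (EuclideanSpace.single j 1) (A (EuclideanSpace.single j 1)) := by
  -- Rescaled to an isometry, L carries the standard basis to another orthonormal basis `e`, so the
  -- claim becomes basis independence of ∑ c(e_j) A e_j.
  let Q : Vec m →ₗᵢ[ℝ] Vec m := ⟨ρ⁻¹ • L, fun y => by
    rw [LinearMap.smul_apply, norm_smul, hL, Real.norm_of_nonneg (inv_nonneg.2 hρ.le)]
    field_simp⟩
  have hLQ : ∀ y, L y = ρ • Q y := by
    intro y
    change L y = ρ • (ρ⁻¹ • L y)
    rw [smul_smul, mul_inv_cancel₀ hρ.ne', one_smul]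
  let e : OrthonormalBasis (Fin (m + 1)) ℝ (Vec m) :=
    (EuclideanSpace.basisFun (Fin (m + 1)) ℝ).map (Q.toLinearIsometryEquiv rfl)
  have he : ∀ j, Q (EuclideanSpace.single j 1) = e j := by
    intro j; simp [e]
  have hex : ∀ j, cmul M (e j) (A (e j)) =
      ∑ i, ∑ l, (inner ℝ (EuclideanSpace.single i 1 : Vec m) (e j) *
        inner ℝ (e j) (EuclideanSpace.single l 1 : Vec m)) •
        M.E i (A (EuclideanSpace.single l 1)) := by
    intro j
    have h1 : A (e j) = ∑ l, inner ℝ (e j) (EuclideanSpace.single l 1 : Vec m) •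
        A (EuclideanSpace.single l 1) := by
      conv_lhs => rw [← sum_single (e j)]
      simp only [map_sum, map_smul, inner_single_right]
    rw [cmul_apply, h1]
    refine Finset.sum_congr rfl fun i _ => ?_
    rw [real_inner_comm, inner_single_right, map_sum, Finset.smul_sum]
    refine Finset.sum_congr rfl fun l _ => ?_
    rw [LinearMap.map_smul_of_tower, smul_smul]
  simp only [hLQ, map_smul, smul_apply, ← Finset.smul_sum, he, smul_smul, hex]
  rw [sq]
  congr 1
  rw [Finset.sum_comm]
  refine Finset.sum_congr rfl fun i _ => ?_
  rw [Finset.sum_comm]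
  -- Parseval for `e` turns the coefficient of E_i A(e_l) into δ_il.
  simp only [← Finset.sum_smul, e.sum_inner_mul_inner]
  simp only [inner_single_right]
  simp [cmul_single]

end Analysis

/-! ### First order identities for the inversion and the Kelvin transforms -/

section Kelvin

variable {m : ℕ} {S : Type*} [NormedAddCommGroup S] [InnerProductSpace ℂ S]
  [FiniteDimensional ℂ S] (M : CliffordModule m S)

/-- The function `|x|^{2p}`. -/
noncomputable def qpow (p : ℝ) (x : Vec m) : ℝ := (‖x‖ ^ 2) ^ p

theorem qpow_add {x : Vec m} (hx : x ≠ 0) (p r : ℝ) : qpow (p + r) x = qpow p x * qpow r x :=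
  Real.rpow_add (by positivity) p r

theorem qpow_one (x : Vec m) : qpow 1 x = ‖x‖ ^ 2 := Real.rpow_one _

theorem hasFDerivAt_qpow {x : Vec m} (hx : x ≠ 0) (p : ℝ) :
    HasFDerivAt (qpow p) ((2 * p * qpow (p - 1) x) • innerSL ℝ x) x := by
  have h := (hasStrictFDerivAt_norm_sq x).hasFDerivAt.rpow_const (p := p)
    (Or.inl (by positivity))
  refine h.congr_fderiv ?_
  ext v
  simp [qpow]
  ring

theorem contDiffAt_qpow {x : Vec m} (hx : x ≠ 0) (p : ℝ) : ContDiffAt ℝ ∞ (qpow p) x :=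
  ((contDiff_norm_sq ℝ).contDiffAt).rpow_const_of_ne (by positivity)

/-- The inversion `x ↦ x / |x|^2` in the unit sphere. -/
noncomputable def inversion (x : Vec m) : Vec m := qpow (-1) x • x

theorem hasFDerivAt_inversion {x : Vec m} (hx : x ≠ 0) :
    HasFDerivAt inversion (qpow (-1) x • ContinuousLinearMap.id ℝ (Vec m) +
      (((-2) * qpow (-2) x) • innerSL ℝ x).smulRight x) x := by
  have h := (hasFDerivAt_qpow hx (-1)).fun_smul (hasFDerivAt_id x)
  refine h.congr_fderiv ?_
  norm_num

theorem contDiffAt_inversion {x : Vec m} (hx : x ≠ 0) : ContDiffAt ℝ ∞ inversion x :=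
  (contDiffAt_qpow hx _).smul contDiffAt_id

/-- The Euler operator `∑ x_j ∂/∂x_j`. -/
noncomputable def euler (f : Vec m → S) (x : Vec m) : S := fderiv ℝ f x x

theorem dirac_smul_radial {φ : Vec m → ℝ} {κ : ℝ} {f : Vec m → S} {x : Vec m}
    (hφ : HasFDerivAt φ (κ • innerSL ℝ x) x) (hf : DifferentiableAt ℝ f x) :
    dirac M (fun y => φ y • f y) x = φ x • dirac M f x + κ • cmul M x (f x) := by
  rw [dirac_eq M (hφ.fun_smul hf.hasFDerivAt), map_add, map_smul, dirac_eq M hf.hasFDerivAt]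
  have : ((κ • innerSL ℝ x).smulRight (f x) : Vec m →L[ℝ] S) =
      κ • (innerSL ℝ x).smulRight (f x) := by
    ext v; simp [mul_smul]
  rw [this, map_smul, diracSymbol_smulRight]

omit [FiniteDimensional ℂ S] in
theorem euler_smul_radial {φ : Vec m → ℝ} {κ : ℝ} {f : Vec m → S} {x : Vec m}
    (hφ : HasFDerivAt φ (κ • innerSL ℝ x) x) (hf : DifferentiableAt ℝ f x) :
    euler (fun y => φ y • f y) x = φ x • euler f x + (κ * ‖x‖ ^ 2) • f x := by
  rw [euler, (hφ.fun_smul hf.hasFDerivAt).fderiv]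
  simp [euler]

theorem hasFDerivAt_cmul {f : Vec m → S} {x : Vec m} (hf : DifferentiableAt ℝ f x) :
    HasFDerivAt (fun y => cmul M y (f y))
      ((cmul M x).comp (fderiv ℝ f x) + (cmul M).flip (f x)) x :=
  (cmul M).hasFDerivAt.clm_apply hf.hasFDerivAt

theorem dirac_cmul {f : Vec m → S} {x : Vec m} (hf : DifferentiableAt ℝ f x) :
    dirac M (fun y => cmul M y (f y)) x =
      -cmul M x (dirac M f x) - (2 : ℝ) • euler f x - ((m : ℝ) + 1) • f x := by
  rw [dirac_eq M (hasFDerivAt_cmul M hf), map_add, diracSymbol_cmul_comp, diracSymbol_flip_cmul,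
    dirac_eq M hf.hasFDerivAt, euler]
  module

theorem euler_cmul {f : Vec m → S} {x : Vec m} (hf : DifferentiableAt ℝ f x) :
    euler (fun y => cmul M y (f y)) x = cmul M x (euler f x) + cmul M x (f x) := by
  rw [euler, (hasFDerivAt_cmul M hf).fderiv]
  simp [euler]

/-- The differential of the inversion is |x|^{-2} times the reflection v ↦ v - 2(x,v)x/|x|². Its
rank one part differentiates h in the direction of x, hence the Euler term. -/
theorem dirac_comp_inversion {h : Vec m → S} {x : Vec m} (hx : x ≠ 0)
    (hh : DifferentiableAt ℝ h (inversion x)) :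
    dirac M (fun y => h (inversion y)) x = qpow (-1) x • dirac M h (inversion x)
      - (2 * qpow (-1) x) • cmul M x (euler h (inversion x)) := by
  have e := hh.hasFDerivAt.comp x (hasFDerivAt_inversion hx)
  have e2 : (fderiv ℝ h (inversion x)).comp (qpow (-1) x • ContinuousLinearMap.id ℝ (Vec m) +
      (((-2) * qpow (-2) x) • innerSL ℝ x).smulRight x) =
      qpow (-1) x • fderiv ℝ h (inversion x) +
      (-2 * qpow (-1) x) • (innerSL ℝ x).smulRight (fderiv ℝ h (inversion x) (inversion x)) := by
    have h2 : qpow (-2) x = qpow (-1) x * qpow (-1) x := by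
      rw [← qpow_add hx]; norm_num
    ext v
    simp [h2, inversion, smul_smul]
    ring_nf
  change dirac M (h ∘ inversion) x = _
  rw [dirac_eq M e, e2, map_add, map_smul, map_smul, diracSymbol_smulRight,
    dirac_eq M hh.hasFDerivAt, euler]
  module

-- The inversion reverses dilations, hence the sign.
omit [FiniteDimensional ℂ S] in
theorem euler_comp_inversion {h : Vec m → S} {x : Vec m} (hx : x ≠ 0)
    (hh : DifferentiableAt ℝ h (inversion x)) :
    euler (fun y => h (inversion y)) x = -euler h (inversion x) := by
  have e := hh.hasFDerivAt.comp x (hasFDerivAt_inversion hx)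
  change euler (h ∘ inversion) x = _
  rw [euler, e.fderiv, euler, ContinuousLinearMap.comp_apply]
  rw [← map_neg]
  congr 1
  have h2 : qpow (-2) x * ‖x‖ ^ 2 = qpow (-1) x := by
    rw [← qpow_one, ← qpow_add hx]; norm_num
  simp [inversion, mul_assoc, h2]
  module

/-- The Kelvin-type transform `|x|^{2p} h(x / |x|^2)`. -/
noncomputable def kelvinScalar (p : ℝ) (h : Vec m → S) (x : Vec m) : S :=
  qpow p x • h (inversion x)

/-- The Kelvin-type transform `|x|^{2p} c(x) h(x / |x|^2)`. -/
noncomputable def kelvin (p : ℝ) (h : Vec m → S) (x : Vec m) : S :=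
  qpow p x • cmul M x (h (inversion x))

omit [FiniteDimensional ℂ S] in
theorem differentiableAt_comp_inversion {h : Vec m → S} {x : Vec m} (hx : x ≠ 0)
    (hh : DifferentiableAt ℝ h (inversion x)) :
    DifferentiableAt ℝ (fun y => h (inversion y)) x :=
  hh.comp x (hasFDerivAt_inversion hx).differentiableAt

/-- D exchanges the scalar and the Clifford-valued transform up to terms of the same kind, so this
formula is needed to apply D twice to `kelvin`. -/
theorem dirac_kelvinScalar {h : Vec m → S} {x : Vec m} (hx : x ≠ 0) (p : ℝ)
    (hh : DifferentiableAt ℝ h (inversion x)) :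
    dirac M (kelvinScalar p h) x =
      kelvin M (p - 1) (fun y => (2 * p) • h y - (2 : ℝ) • euler h y) x
      + kelvinScalar (p - 1) (dirac M h) x := by
  have hq : qpow (p - 1) x = qpow p x * qpow (-1) x := by rw [← qpow_add hx]; rfl
  unfold kelvinScalar kelvin
  rw [dirac_smul_radial M (hasFDerivAt_qpow hx p) (differentiableAt_comp_inversion hx hh),
    dirac_comp_inversion M hx hh, map_sub, map_smul, map_smul, hq]
  module

/-- The Euler derivative of h enters twice, from D acting past c(x) and from the chain rule with
c(x)² = -|x|², with opposite signs. The remaining order zero coefficient vanishes exactly for p =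
-n/2, which is the case k = 0 of the intertwining identity. -/
theorem dirac_kelvin {h : Vec m → S} {x : Vec m} (hx : x ≠ 0) (p : ℝ)
    (hh : DifferentiableAt ℝ h (inversion x)) :
    dirac M (kelvin M p h) x = (-(2 * p + (m + 1))) • kelvinScalar p h x
      - kelvin M (p - 1) (dirac M h) x := by
  have hq : qpow p x = qpow (p - 1) x * ‖x‖ ^ 2 := by
    rw [← qpow_one, ← qpow_add hx]; norm_num
  have hq1 : qpow (-1) x * ‖x‖ ^ 2 = 1 := by
    rw [← qpow_one, ← qpow_add hx]; simp [qpow]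
  have hd := differentiableAt_comp_inversion hx hh
  unfold kelvinScalar kelvin
  rw [dirac_smul_radial M (hasFDerivAt_qpow hx p) (hasFDerivAt_cmul M hd).differentiableAt,
    dirac_cmul M hd, dirac_comp_inversion M hx hh, euler_comp_inversion hx hh]
  simp only [map_sub, map_smul, cmul_cmul, smul_smul]
  rw [mul_assoc 2 (qpow (-1) x), mul_neg (qpow (-1) x), hq1, hq]
  have : qpow (p - 1) x * ‖x‖ ^ 2 * qpow (-1) x = qpow (p - 1) x := by
    rw [mul_assoc, mul_comm _ (qpow (-1) x), hq1, mul_one]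
  simp only [smul_sub, smul_neg, smul_smul, this]
  module

theorem euler_kelvin {h : Vec m → S} {x : Vec m} (hx : x ≠ 0) (p : ℝ)
    (hh : DifferentiableAt ℝ h (inversion x)) :
    euler (kelvin M p h) x = (2 * p + 1) • kelvin M p h x - kelvin M p (euler h) x := by
  have hq : qpow p x = qpow (p - 1) x * ‖x‖ ^ 2 := by
    rw [← qpow_one, ← qpow_add hx]; norm_num
  have hd := differentiableAt_comp_inversion hx hh
  unfold kelvin
  rw [euler_smul_radial (hasFDerivAt_qpow hx p) (hasFDerivAt_cmul M hd).differentiableAt,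
    euler_cmul M hd, euler_comp_inversion hx hh, hq, map_neg]
  module

end Kelvin

/-! ### Commutators of powers of D with |x|², and the Kelvin identity for odd powers -/

section Iterates

variable {m : ℕ} {S : Type*} [NormedAddCommGroup S] [InnerProductSpace ℂ S]
  [FiniteDimensional ℂ S] (M : CliffordModule m S)

theorem contDiffAt_dirac {f : Vec m → S} {x : Vec m} (hf : ContDiffAt ℝ ∞ f x) :
    ContDiffAt ℝ ∞ (dirac M f) x := by
  have h : ContDiffAt ℝ ∞ (fderiv ℝ f) x := hf.fderiv_right (m := ∞) (by simp)
  refine ContDiffAt.sum fun j _ => ?_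
  exact ((LinearMap.toContinuousLinearMap (M.E j)).restrictScalars ℝ).contDiff.contDiffAt.comp x
    (h.clm_apply contDiffAt_const)

theorem contDiffAt_dirac_iterate {f : Vec m → S} {x : Vec m} (hf : ContDiffAt ℝ ∞ f x) (k : ℕ) :
    ContDiffAt ℝ ∞ ((dirac M)^[k] f) x := by
  induction k with
  | zero => exact hf
  | succ k ih => rw [Function.iterate_succ_apply']; exact contDiffAt_dirac M ih

theorem contDiff_dirac_iterate {f : Vec m → S} (hf : ContDiff ℝ ∞ f) (k : ℕ) :
    ContDiff ℝ ∞ ((dirac M)^[k] f) :=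
  contDiff_iff_contDiffAt.2 fun _ => contDiffAt_dirac_iterate M hf.contDiffAt k

omit [FiniteDimensional ℂ S] in
theorem contDiffAt_euler {f : Vec m → S} {x : Vec m} (hf : ContDiffAt ℝ ∞ f x) :
    ContDiffAt ℝ ∞ (euler f) x :=
  (hf.fderiv_right (m := ∞) (by simp)).clm_apply contDiffAt_id

theorem contDiffAt_cmul {f : Vec m → S} {x : Vec m} (hf : ContDiffAt ℝ ∞ f x) :
    ContDiffAt ℝ ∞ (fun y => cmul M y (f y)) x :=
  (cmul M).contDiff.contDiffAt.clm_apply hf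

theorem dirac_congr {f g : Vec m → S} {x : Vec m} (h : f =ᶠ[𝓝 x] g) :
    dirac M f =ᶠ[𝓝 x] dirac M g :=
  (h.fderiv (𝕜 := ℝ)).mono fun y hy => by simp only [dirac, hy]

theorem dirac_iterate_congr {f g : Vec m → S} {x : Vec m} (h : f =ᶠ[𝓝 x] g) (k : ℕ) :
    (dirac M)^[k] f =ᶠ[𝓝 x] (dirac M)^[k] g := by
  induction k with
  | zero => exact h
  | succ k ih => simp only [Function.iterate_succ_apply']; exact dirac_congr M ih

theorem dirac_eqOn {f g : Vec m → S} {Ω : Set (Vec m)} (hΩ : IsOpen Ω) (h : Set.EqOn f g Ω) :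
    Set.EqOn (dirac M f) (dirac M g) Ω := fun _ hx =>
  (dirac_congr M (h.eventuallyEq_of_mem (hΩ.mem_nhds hx))).eq_of_nhds

omit [FiniteDimensional ℂ S] in
theorem euler_eqOn {f g : Vec m → S} {Ω : Set (Vec m)} (hΩ : IsOpen Ω) (h : Set.EqOn f g Ω) :
    Set.EqOn (euler f) (euler g) Ω := fun x hx => by
  rw [euler, euler, (h.eventuallyEq_of_mem (hΩ.mem_nhds hx)).fderiv_eq]

theorem dirac_add {f g : Vec m → S} {x : Vec m} (hf : DifferentiableAt ℝ f x)
    (hg : DifferentiableAt ℝ g x) :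
    dirac M (fun y => f y + g y) x = dirac M f x + dirac M g x := by
  rw [dirac_eq M (hf.hasFDerivAt.fun_add hg.hasFDerivAt), map_add, ← dirac_eq M hf.hasFDerivAt,
    ← dirac_eq M hg.hasFDerivAt]

theorem dirac_const_smul {f : Vec m → S} {x : Vec m} (r : ℝ) (hf : DifferentiableAt ℝ f x) :
    dirac M (fun y => r • f y) x = r • dirac M f x := by
  rw [dirac_eq M (hf.hasFDerivAt.fun_const_smul r), map_smul, ← dirac_eq M hf.hasFDerivAt]

/-- D is homogeneous of degree -1. In the proof, the second order terms agree by symmetry of the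
second derivative, and differentiating the coefficient x gives the extra Df. -/
theorem dirac_euler {f : Vec m → S} {x : Vec m} (hf : ContDiffAt ℝ ∞ f x) :
    dirac M (euler f) x = euler (dirac M f) x + dirac M f x := by
  have hd : DifferentiableAt ℝ (fderiv ℝ f) x :=
    (hf.fderiv_right (m := ∞) (by simp)).differentiableAt (by simp)
  have hs : IsSymmSndFDerivAt ℝ f x := by
    refine hf.isSymmSndFDerivAt ?_
    simp only [minSmoothness_of_isRCLikeNormedField]
    exact WithTop.coe_le_coe.2 (le_top : (2 : ℕ∞) ≤ ⊤)
  have h1 := hd.hasFDerivAt.clm_apply (hasFDerivAt_id x)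
  have h2 : HasFDerivAt (dirac M f) (∑ j, ((LinearMap.toContinuousLinearMap
      (M.E j)).restrictScalars ℝ).comp
        ((fderiv ℝ (fderiv ℝ f) x).flip (EuclideanSpace.single j 1))) x := by
    refine HasFDerivAt.fun_sum fun j _ => ?_
    refine ((LinearMap.toContinuousLinearMap (M.E j)).restrictScalars ℝ).hasFDerivAt.comp x ?_
    refine (hd.hasFDerivAt.clm_apply (hasFDerivAt_const _ x)).congr_fderiv ?_
    simp
  have h3 : dirac M (euler f) x = _ := dirac_eq M h1
  rw [h3, map_add, euler, h2.fderiv, add_comm]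
  congr 1
  · simp only [diracSymbol, LinearMap.coe_mk, AddHom.coe_mk, sum_apply,
      ContinuousLinearMap.comp_apply, ContinuousLinearMap.flip_apply]
    refine Finset.sum_congr rfl fun j _ => ?_
    rw [hs.eq]
    rfl

theorem euler_add_const_smul_dirac {f : Vec m → S} {x : Vec m} (r : ℝ)
    (hf : ContDiffAt ℝ ∞ f x) :
    dirac M (fun y => euler f y + r • f y) x =
      euler (dirac M f) x + (r + 1) • dirac M f x := by
  have hd := hf.differentiableAt (by simp)
  rw [dirac_add M ((contDiffAt_euler hf).differentiableAt (by simp)) (hd.fun_const_smul r),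
    dirac_euler M hf, dirac_const_smul M r hd]
  module

theorem dirac_norm_sq_smul {f : Vec m → S} {x : Vec m} (hf : DifferentiableAt ℝ f x) :
    dirac M (fun y => ‖y‖ ^ 2 • f y) x = ‖x‖ ^ 2 • dirac M f x + (2 : ℝ) • cmul M x (f x) :=
  dirac_smul_radial M
    ((hasStrictFDerivAt_norm_sq x).hasFDerivAt.congr_fderiv (by ext v; simp)) hf

omit [FiniteDimensional ℂ S] in
theorem contDiffAt_norm_sq_smul {f : Vec m → S} {x : Vec m} (hf : ContDiffAt ℝ ∞ f x) :
    ContDiffAt ℝ ∞ (fun y => ‖y‖ ^ 2 • f y) x :=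
  (contDiff_norm_sq ℝ).contDiffAt.smul hf

theorem dirac_dirac_norm_sq_smul {f : Vec m → S} {Ω : Set (Vec m)} (hΩ : IsOpen Ω)
    (hf : ∀ x ∈ Ω, ContDiffAt ℝ ∞ f x) :
    Set.EqOn (dirac M (dirac M (fun y => ‖y‖ ^ 2 • f y)))
      (fun x => ‖x‖ ^ 2 • dirac M (dirac M f) x
        - (4 : ℝ) • (euler f x + (((m : ℝ) + 1) / 2) • f x)) Ω := by
  intro x hx
  have h1 : Set.EqOn (dirac M (fun y => ‖y‖ ^ 2 • f y))
      (fun y => ‖y‖ ^ 2 • dirac M f y + (2 : ℝ) • cmul M y (f y)) Ω := fun y hy =>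
    dirac_norm_sq_smul M ((hf y hy).differentiableAt (by simp))
  have hd := (hf x hx).differentiableAt (by simp)
  have hD := contDiffAt_dirac M (hf x hx)
  have hc := (contDiffAt_cmul M (hf x hx)).differentiableAt (by simp)
  rw [dirac_eqOn M hΩ h1 hx, dirac_add M
    ((contDiffAt_norm_sq_smul hD).differentiableAt (by simp)) (hc.fun_const_smul 2),
    dirac_norm_sq_smul M (hD.differentiableAt (by simp)), dirac_const_smul M 2 hc,
    dirac_cmul M hd]
  module

/-- An sl₂ computation: each further D² contributes -4(E + n/2) from its commutator with |x|² and
shifts the earlier Euler terms by 2. The sum of n/2 and (k+1)(n/2 + k + 2) is (k+2)(n/2 + k + 1). -/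
theorem dirac_iterate_even_norm_sq_smul {f : Vec m → S} {Ω : Set (Vec m)} (hΩ : IsOpen Ω)
    (hf : ∀ x ∈ Ω, ContDiffAt ℝ ∞ f x) (k : ℕ) :
    Set.EqOn ((dirac M)^[2 * k + 2] (fun y => ‖y‖ ^ 2 • f y))
      (fun x => ‖x‖ ^ 2 • (dirac M)^[2 * k + 2] f x
        - (4 * ((k : ℝ) + 1)) • (euler ((dirac M)^[2 * k] f) x
          + (((m : ℝ) + 1) / 2 + k) • (dirac M)^[2 * k] f x)) Ω := by
  induction k with
  | zero =>
    intro x hx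
    have := dirac_dirac_norm_sq_smul M hΩ hf hx
    simpa using this
  | succ k ih =>
    intro x hx
    set F := (dirac M)^[2 * k] f with hF
    have hFs : ∀ x ∈ Ω, ContDiffAt ℝ ∞ F x := fun x hx =>
      contDiffAt_dirac_iterate M (hf x hx) _
    have e1 : (dirac M)^[2 * k + 2] f = dirac M (dirac M F) := by
      rw [Function.iterate_succ_apply', Function.iterate_succ_apply']
    have e2 : ∀ φ : Vec m → S, (dirac M)^[2 * (k + 1) + 2] φ =
        dirac M (dirac M ((dirac M)^[2 * k + 2] φ)) := fun φ => by
      rw [show 2 * (k + 1) + 2 = (2 * k + 2) + 1 + 1 by ring, Function.iterate_succ_apply',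
        Function.iterate_succ_apply']
    have e3 : 2 * (k + 1) = 2 * k + 2 := by ring
    rw [e2, e2, e3, e1]
    rw [e1] at ih
    set G := dirac M (dirac M F) with hG
    have hGs : ∀ x ∈ Ω, ContDiffAt ℝ ∞ G x := fun x hx =>
      contDiffAt_dirac M (contDiffAt_dirac M (hFs x hx))
    have hEs : ∀ (r : ℝ), ∀ φ : Vec m → S, ∀ x, ContDiffAt ℝ ∞ φ x →
        ContDiffAt ℝ ∞ (fun y => euler φ y + r • φ y) x := fun r φ x h =>
      (contDiffAt_euler h).add (h.const_smul r)
    -- Each D moved past E + r replaces r by r + 1.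
    have key : ∀ (r : ℝ), ∀ y ∈ Ω, dirac M (dirac M (fun y => euler F y + r • F y)) y =
        euler G y + (r + 2) • G y := by
      intro r y hy
      have h1 : Set.EqOn (dirac M (fun y => euler F y + r • F y))
        (fun y => euler (dirac M F) y + (r + 1) • dirac M F y) Ω := fun z hz =>
          euler_add_const_smul_dirac M r (hFs z hz)
      rw [dirac_eqOn M hΩ h1 hy, euler_add_const_smul_dirac M _ (contDiffAt_dirac M (hFs y hy))]
      module
    have hsum : ∀ (s : ℝ) (A B : Vec m → S), (∀ x ∈ Ω, ContDiffAt ℝ ∞ A x) →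
        (∀ x ∈ Ω, ContDiffAt ℝ ∞ B x) → Set.EqOn (dirac M (dirac M (fun y => A y - s • B y)))
          (fun y => dirac M (dirac M A) y - s • dirac M (dirac M B) y) Ω := by
      intro s A B hA hB
      have h1 : ∀ A B : Vec m → S, (∀ x ∈ Ω, ContDiffAt ℝ ∞ A x) →
          (∀ x ∈ Ω, ContDiffAt ℝ ∞ B x) → Set.EqOn (dirac M (fun y => A y - s • B y))
          (fun y => dirac M A y - s • dirac M B y) Ω := by
        intro A B hA hB y hy
        have hb := (hB y hy).differentiableAt (by simp)
        simp only [sub_eq_add_neg, ← neg_smul]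
        rw [dirac_add M ((hA y hy).differentiableAt (by simp)) (hb.fun_const_smul (-s)),
          dirac_const_smul M (-s) hb]
      intro y hy
      rw [dirac_eqOn M hΩ (h1 A B hA hB) hy]
      exact h1 _ _ (fun x hx => contDiffAt_dirac M (hA x hx))
        (fun x hx => contDiffAt_dirac M (hB x hx)) hy
    rw [dirac_eqOn M hΩ (dirac_eqOn M hΩ ih) hx, hsum _ _ _
      (fun x hx => contDiffAt_norm_sq_smul (hGs x hx)) (fun x hx => hEs _ _ x (hFs x hx)) hx]
    simp only
    rw [key _ x hx, dirac_dirac_norm_sq_smul M hΩ hGs hx]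
    push_cast
    module

theorem dirac_iterate_odd_norm_sq_smul {f : Vec m → S} {Ω : Set (Vec m)} (hΩ : IsOpen Ω)
    (hf : ∀ x ∈ Ω, ContDiffAt ℝ ∞ f x) (k : ℕ) {x : Vec m} (hx : x ∈ Ω) :
    (dirac M)^[2 * k + 3] (fun y => ‖y‖ ^ 2 • f y) x =
      ‖x‖ ^ 2 • dirac M (dirac M ((dirac M)^[2 * k + 1] f)) x
        + (2 : ℝ) • cmul M x (dirac M ((dirac M)^[2 * k + 1] f) x)
        - (4 * ((k : ℝ) + 1)) • (euler ((dirac M)^[2 * k + 1] f) x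
          + (((m : ℝ) + 1) / 2 + k + 1) • (dirac M)^[2 * k + 1] f x) := by
  have hs := fun j => contDiffAt_dirac_iterate M (hf x hx) j
  rw [Function.iterate_succ_apply', dirac_eqOn M hΩ (dirac_iterate_even_norm_sq_smul M hΩ hf k) hx]
  simp only [sub_eq_add_neg, ← neg_smul]
  rw [dirac_add M ((contDiffAt_norm_sq_smul (hs _)).differentiableAt (by simp))
    ((((contDiffAt_euler (hs _)).add ((hs _).const_smul _)).differentiableAt (by simp)).fun_const_smul
      _), dirac_const_smul M _
    (((contDiffAt_euler (hs _)).add ((hs _).const_smul _)).differentiableAt (by simp)),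
    euler_add_const_smul_dirac M _ (hs _), dirac_norm_sq_smul M ((hs _).differentiableAt (by simp))]
  simp only [Function.iterate_succ_apply']

theorem isOpen_ne_zero : IsOpen {x : Vec m | x ≠ 0} := isOpen_ne

theorem contDiffAt_kelvin {h : Vec m → S} (p : ℝ) (hh : ContDiff ℝ ∞ h) {x : Vec m}
    (hx : x ≠ 0) : ContDiffAt ℝ ∞ (kelvin M p h) x :=
  (contDiffAt_qpow hx p).smul
    (contDiffAt_cmul M (hh.contDiffAt.comp x (contDiffAt_inversion hx)))

omit [FiniteDimensional ℂ S] in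
theorem contDiffAt_kelvinScalar {h : Vec m → S} (p : ℝ) (hh : ContDiff ℝ ∞ h) {x : Vec m}
    (hx : x ≠ 0) : ContDiffAt ℝ ∞ (kelvinScalar p h) x :=
  (contDiffAt_qpow hx p).smul (hh.contDiffAt.comp x (contDiffAt_inversion hx))

/-- The second order identity behind the inductive step of `dirac_iterate_kelvin`. -/
theorem kelvin_step {h : Vec m → S} (hh : ContDiff ℝ ∞ h) {x : Vec m} (hx : x ≠ 0) {κ p : ℝ}
    (hp : 2 * p + (m + 1) = -(2 * κ)) :
    ‖x‖ ^ 2 • dirac M (dirac M (kelvin M p h)) x + (2 : ℝ) • cmul M x (dirac M (kelvin M p h) x)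
      - (4 * κ) • (euler (kelvin M p h) x + (((m : ℝ) + 1) / 2 + κ) • kelvin M p h x) =
    kelvin M (p - 1) (dirac M (dirac M h)) x := by
  have hd : ∀ y, DifferentiableAt ℝ h y := fun y => hh.contDiffAt.differentiableAt (by simp)
  have hDh : ContDiff ℝ ∞ (dirac M h) := contDiff_dirac_iterate M hh 1
  have h1 : ∀ y ∈ {x : Vec m | x ≠ 0}, dirac M (kelvin M p h) y =
      (2 * κ) • kelvinScalar p h y + (-1 : ℝ) • kelvin M (p - 1) (dirac M h) y := by
    intro y hy
    rw [dirac_kelvin M hy p (hd _), hp]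
    module
  have hB := (contDiffAt_kelvinScalar p hh hx).differentiableAt (by simp)
  have hA := (contDiffAt_kelvin M (p - 1) hDh hx).differentiableAt (by simp)
  rw [dirac_eqOn M isOpen_ne_zero h1 hx, h1 x hx, dirac_add M (hB.fun_const_smul _) (hA.fun_const_smul _),
    dirac_const_smul M _ hB, dirac_const_smul M _ hA, dirac_kelvinScalar M hx p (hd _),
    dirac_kelvin M hx _ (hDh.contDiffAt.differentiableAt (by simp)), euler_kelvin M hx p (hd _)]
  have hq1 : qpow p x = qpow (p - 1 - 1) x * ‖x‖ ^ 2 * ‖x‖ ^ 2 := by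
    rw [← qpow_one, ← qpow_add hx, ← qpow_add hx]; ring_nf
  have hq2 : qpow (p - 1) x = qpow (p - 1 - 1) x * ‖x‖ ^ 2 := by
    rw [← qpow_one, ← qpow_add hx]; ring_nf
  -- Equivalently n/2 + κ = -p. With all powers of |x| reduced to |x|^{2(p-2)}, this makes the terms
  -- in h, E h and D h cancel, leaving only D²h.
  have hm : (m : ℝ) + 1 = -(2 * κ) - 2 * p := by linarith
  unfold kelvin kelvinScalar
  simp only [map_add, map_sub, map_smul, cmul_cmul, hq1, hq2, hm]
  module

/-- The intertwining property of the Kelvin transform and the odd powers of the Dirac operator. -/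
theorem dirac_iterate_kelvin (k : ℕ) {h : Vec m → S} (hh : ContDiff ℝ ∞ h) {x : Vec m}
    (hx : x ≠ 0) :
    (dirac M)^[2 * k + 1] (kelvin M (k - ((m : ℝ) + 1) / 2) h) x =
      -kelvin M (-k - 1 - ((m : ℝ) + 1) / 2) ((dirac M)^[2 * k + 1] h) x := by
  induction k generalizing x with
  | zero =>
    have := dirac_kelvin M hx (((0 : ℕ) : ℝ) - ((m : ℝ) + 1) / 2)
      (hh.contDiffAt.differentiableAt (x := inversion x) (by simp))
    simp only [mul_zero, zero_add, Function.iterate_one]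
    rw [this, show -(2 * (((0 : ℕ) : ℝ) - ((m : ℝ) + 1) / 2) + (m + 1)) = 0 by push_cast; ring,
      zero_smul, zero_sub]
    congr 2
    push_cast; ring
  | succ k ih =>
    set p : ℝ := k - ((m : ℝ) + 1) / 2 with hp
    -- Passing from k to k + 1 multiplies the transform by |x|², so the commutator formula applies
    -- to D^{2k+3}.
    have e1 : Set.EqOn (kelvin M (((k + 1 : ℕ) : ℝ) - ((m : ℝ) + 1) / 2) h)
        (fun y => ‖y‖ ^ 2 • kelvin M p h y) {x : Vec m | x ≠ 0} := by
      intro y hy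
      have : ((k + 1 : ℕ) : ℝ) - ((m : ℝ) + 1) / 2 = 1 + p := by push_cast; ring
      simp only [kelvin, this, qpow_add (show y ≠ 0 from hy), qpow_one, mul_smul]
    rw [show 2 * (k + 1) + 1 = 2 * k + 3 by ring, (dirac_iterate_congr M
      (e1.eventuallyEq_of_mem (isOpen_ne_zero.mem_nhds hx)) _).eq_of_nhds,
      dirac_iterate_odd_norm_sq_smul M isOpen_ne_zero
        (fun y hy => contDiffAt_kelvin M p hh hy) k hx]
    set p' : ℝ := -k - 1 - ((m : ℝ) + 1) / 2 with hp'
    set H := (dirac M)^[2 * k + 1] h with hH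
    have hHs : ContDiff ℝ ∞ H := contDiff_dirac_iterate M hh _
    -- The sign of the induction hypothesis is absorbed into the transformed function, so that the
    -- second order identity applies verbatim.
    have e2 : Set.EqOn ((dirac M)^[2 * k + 1] (kelvin M p h))
        (kelvin M p' (fun y => (-1 : ℝ) • H y)) {x : Vec m | x ≠ 0} := by
      intro y hy
      rw [ih hy]
      simp [kelvin]
    -- κ = k + 1 comes from the coefficient 4(k + 1) of the commutator, and 2p' + n = -2(k + 1).
    have hs := kelvin_step M (hHs.const_smul (-1 : ℝ)) hx (κ := k + 1) (p := p')
      (by rw [hp']; ring)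
    have e3 : dirac M (dirac M (fun y => (-1 : ℝ) • H y)) =
        fun y => (-1 : ℝ) • dirac M (dirac M H) y := by
      have : ∀ φ : Vec m → S, ContDiff ℝ ∞ φ → dirac M (fun y => (-1 : ℝ) • φ y) =
          fun y => (-1 : ℝ) • dirac M φ y := fun φ hφ => funext fun y =>
        dirac_const_smul M _ (hφ.contDiffAt.differentiableAt (by simp))
      rw [this _ hHs, this (dirac M H) (contDiff_dirac_iterate M hHs 1)]
    have e4 : (dirac M)^[2 * k + 3] h = dirac M (dirac M H) := by
      rw [Function.iterate_succ_apply', Function.iterate_succ_apply']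
    rw [e2 hx, dirac_eqOn M isOpen_ne_zero e2 hx,
      dirac_eqOn M isOpen_ne_zero (dirac_eqOn M isOpen_ne_zero e2) hx,
      euler_eqOn isOpen_ne_zero e2 hx, add_assoc (((m : ℝ) + 1) / 2)]
    refine hs.trans ?_
    rw [e3, e4, show p' - 1 = -((k + 1 : ℕ) : ℝ) - 1 - ((m : ℝ) + 1) / 2 by
      rw [hp']; push_cast; ring]
    simp [kelvin]

end Iterates

/-! ### Similarities, translations and scalars -/

section Affine

variable {m : ℕ} {S : Type*} [NormedAddCommGroup S] [InnerProductSpace ℂ S]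
  [FiniteDimensional ℂ S] (M : CliffordModule m S)

/-- Moving c(e_j) past T turns it into μ c(L e_j), which pairs with the derivative along L e_j; the
conformal sum then yields ρ². -/
theorem dirac_comp_similarity {L : Vec m →ₗ[ℝ] Vec m} {ρ μ : ℝ} (hρ : 0 < ρ)
    (hL : ∀ y, ‖L y‖ = ρ * ‖y‖) {T : Module.End ℂ S}
    (hT : ∀ y v, cmul M y (T v) = μ • T (cmul M (L y) v)) (w : Vec m) {f : Vec m → S}
    {x : Vec m} (hf : DifferentiableAt ℝ f (L x + w)) :
    dirac M (fun y => T (f (L y + w))) x = (μ * ρ ^ 2) • T (dirac M f (L x + w)) := by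
  have hA : HasFDerivAt (fun y => L y + w) (LinearMap.toContinuousLinearMap L) x :=
    (LinearMap.toContinuousLinearMap L).hasFDerivAt.add_const w
  have h := ((LinearMap.toContinuousLinearMap T).restrictScalars ℝ).hasFDerivAt.comp x
    (hf.hasFDerivAt.comp x hA)
  have h2 : dirac M (fun y => T (f (L y + w))) x = _ := dirac_eq M h
  rw [h2, dirac_eq M hf.hasFDerivAt, diracSymbol_apply, diracSymbol_apply]
  have h3 := diracSymbol_comp_conformal M hρ hL (fderiv ℝ f (L x + w)).toLinearMap
  simp only [ContinuousLinearMap.coe_coe] at h3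
  simp only [ContinuousLinearMap.comp_apply, ContinuousLinearMap.coe_restrictScalars',
    LinearMap.coe_toContinuousLinearMap', hT]
  rw [← Finset.smul_sum, ← map_sum, h3, LinearMap.map_smul_of_tower, smul_smul]

theorem dirac_iterate_comp_similarity {L : Vec m →ₗ[ℝ] Vec m} {ρ μ : ℝ} (hρ : 0 < ρ)
    (hL : ∀ y, ‖L y‖ = ρ * ‖y‖) {T : Module.End ℂ S}
    (hT : ∀ y v, cmul M y (T v) = μ • T (cmul M (L y) v)) (w : Vec m) {f : Vec m → S}
    (hf : ContDiff ℝ ∞ f) (k : ℕ) :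
    (dirac M)^[k] (fun y => T (f (L y + w))) =
      fun x => (μ * ρ ^ 2) ^ k • T ((dirac M)^[k] f (L x + w)) := by
  induction k with
  | zero => simp
  | succ k ih =>
    funext x
    have hs := contDiff_dirac_iterate M hf k
    have hd := fun y => hs.contDiffAt.differentiableAt (x := y) (by simp)
    have hc : Differentiable ℝ fun y => T ((dirac M)^[k] f (L y + w)) := fun y =>
      ((LinearMap.toContinuousLinearMap T).restrictScalars ℝ).differentiableAt.comp y
        ((hd _).comp y ((LinearMap.toContinuousLinearMap L).differentiableAt.add_const w))
    rw [Function.iterate_succ_apply', ih, dirac_const_smul M _ (hc x),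
      dirac_comp_similarity M hρ hL hT w (hd _), Function.iterate_succ_apply', smul_smul,
      ← pow_succ]

theorem dirac_comp_sub (p : Vec m) (f : Vec m → S) :
    dirac M (fun y => f (y - p)) = fun x => dirac M f (x - p) := by
  funext x
  simp only [dirac, fderiv_comp_sub]

theorem dirac_iterate_comp_sub (p : Vec m) (f : Vec m → S) (k : ℕ) :
    (dirac M)^[k] (fun y => f (y - p)) = fun x => (dirac M)^[k] f (x - p) := by
  induction k with
  | zero => rfl
  | succ k ih => simp only [Function.iterate_succ_apply', ih, dirac_comp_sub]

theorem dirac_iterate_const_smul (r : ℝ) {f : Vec m → S} (hf : ContDiff ℝ ∞ f) (k : ℕ) :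
    (dirac M)^[k] (fun y => r • f y) = fun x => r • (dirac M)^[k] f x := by
  induction k with
  | zero => rfl
  | succ k ih =>
    funext x
    rw [Function.iterate_succ_apply', ih, dirac_const_smul M r
      ((contDiff_dirac_iterate M hf k).contDiffAt.differentiableAt (by simp)),
      Function.iterate_succ_apply']

end Affine

/-! ### Vectors, norm and twisted conjugation in the Clifford group -/

section Clifford

variable {m : ℕ}

theorem vec_add (x y : Vec m) : vec (x + y) = vec x + vec y := by
  have : (fun j : Fin m => (x + y) j.succ) = (fun j => x j.succ) + fun j => y j.succ := rfl
  rw [vec, this, map_add, PiLp.add_apply, map_add, vec, vec]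
  abel

theorem vec_smul (r : ℝ) (x : Vec m) : vec (r • x) = r • vec x := by
  have : (fun j : Fin m => (r • x) j.succ) = r • fun j => x j.succ := rfl
  rw [vec, this, map_smul, PiLp.smul_apply, vec, smul_add, smul_eq_mul, map_mul,
    ← Algebra.smul_def]

theorem vec_neg (x : Vec m) : vec (-x) = -vec x := by
  rw [← neg_one_smul ℝ, vec_smul, neg_one_smul]

theorem vec_sub (x y : Vec m) : vec (x - y) = vec x - vec y := by
  rw [sub_eq_add_neg, vec_add, vec_neg, sub_eq_add_neg]

/-- The conjugation of `E^n`, fixing `e_1` and changing the sign of the other basis vectors. -/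
noncomputable def bar : Vec m →ₗ[ℝ] Vec m where
  toFun x := (2 * x 0) • EuclideanSpace.single 0 1 - x
  map_add' x y := by
    rw [PiLp.add_apply]; module
  map_smul' r x := by
    rw [PiLp.smul_apply, smul_eq_mul, RingHom.id_apply]; module

theorem bar_bar (x : Vec m) : bar (bar x) = x := by
  simp [bar]
  module

theorem prime_vec (x : Vec m) : prime (vec x) = vec (bar x) := by
  have h : (fun j : Fin m => (bar x) j.succ) = -fun j => x j.succ := by
    funext j; simp [bar]
  have h0 : bar x 0 = x 0 := by simp [bar]; ring
  rw [vec, vec, h, h0, prime, map_add, CliffordAlgebra.involute_ι, AlgHom.commutes, map_neg]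

theorem rev_vec (x : Vec m) : rev (vec x) = vec x := by
  rw [vec, rev, map_add, CliffordAlgebra.reverse_ι, CliffordAlgebra.reverse.commutes]

theorem rev_mul (a b : Cl m) : rev (a * b) = rev b * rev a := CliffordAlgebra.reverse.map_mul a b

theorem rev_zero : rev (0 : Cl m) = 0 := map_zero CliffordAlgebra.reverse

theorem rev_sub (a b : Cl m) : rev (a - b) = rev a - rev b := map_sub CliffordAlgebra.reverse a b

theorem vec_zero : vec (0 : Vec m) = 0 := by
  rw [← zero_smul ℝ (0 : Vec m), vec_smul, zero_smul]

theorem rev_rev (a : Cl m) : rev (rev a) = a := CliffordAlgebra.reverse_reverse a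

theorem prime_mul (a b : Cl m) : prime (a * b) = prime a * prime b := map_mul _ a b

theorem prime_algebraMap (r : ℝ) : prime (algebraMap ℝ (Cl m) r) = algebraMap ℝ (Cl m) r :=
  AlgHom.commutes _ r

theorem conj_one : conj (1 : Cl m) = 1 := by
  rw [conj, prime, map_one, rev, CliffordAlgebra.reverse.map_one]

theorem prime_prime (a : Cl m) : prime (prime a) = a := CliffordAlgebra.involute_involute a

theorem rev_prime (a : Cl m) : rev (prime a) = prime (rev a) :=
  CliffordAlgebra.reverse_involute_commute a

theorem conj_mul (a b : Cl m) : conj (a * b) = conj b * conj a := by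
  rw [conj, prime, map_mul, rev_mul]

theorem conj_vec (x : Vec m) : conj (vec x) = vec (bar x) := by
  rw [conj, prime_vec, rev_vec]

theorem norm_sq_eq (x : Vec m) : ‖x‖ ^ 2 = x 0 * x 0 + ∑ j : Fin m, x j.succ * x j.succ := by
  rw [EuclideanSpace.norm_sq_eq, Fin.sum_univ_succ]
  simp [sq]

theorem vec_mul_vec_bar (x : Vec m) : vec x * vec (bar x) = algebraMap ℝ (Cl m) (‖x‖ ^ 2) := by
  rw [← prime_vec, vec, prime, map_add, CliffordAlgebra.involute_ι, AlgHom.commutes, norm_sq_eq]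
  have h := CliffordAlgebra.ι_sq_scalar (negSq m) (fun j => x j.succ)
  rw [negSq_apply, map_neg] at h
  rw [map_add, map_mul, ← neg_eq_iff_eq_neg.2 h, add_mul, mul_add, mul_add, mul_neg, mul_neg,
    ← Algebra.commutes (x 0) (CliffordAlgebra.ι (negSq m) fun j => x j.succ)]
  abel

theorem vec_bar_mul_vec (x : Vec m) : vec (bar x) * vec x = algebraMap ℝ (Cl m) (‖x‖ ^ 2) := by
  have h := congrArg prime (vec_mul_vec_bar x)
  rwa [prime_mul, prime_algebraMap, prime_vec, prime_vec, bar_bar] at h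

theorem algebraMap_injective : Function.Injective (algebraMap ℝ (Cl m)) :=
  (algebraMap ℝ (Cl m)).injective

theorem norm_bar (x : Vec m) : ‖bar x‖ = ‖x‖ := by
  have h := vec_mul_vec_bar (bar x)
  rw [bar_bar, vec_bar_mul_vec] at h
  have h2 := algebraMap_injective h
  exact (sq_eq_sq₀ (norm_nonneg _) (norm_nonneg _)).1 h2.symm

theorem vec_injective : Function.Injective (vec (m := m)) := by
  intro x y h
  have h0 : vec (x - y) = 0 := by rw [vec_sub, h, sub_self]
  have h1 := vec_mul_vec_bar (x - y)
  rw [h0, zero_mul, eq_comm, map_eq_zero_iff _ algebraMap_injective] at h1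
  exact sub_eq_zero.1 (norm_eq_zero.1 (pow_eq_zero_iff two_ne_zero |>.1 h1))

theorem ofVec_vec (x : Vec m) : ofVec (vec x) = x := Function.leftInverse_invFun vec_injective x

theorem scalarPart_algebraMap (r : ℝ) : scalarPart (algebraMap ℝ (Cl m) r) = r := by
  simp [scalarPart, CliffordAlgebra.equivExterior]

theorem vec_mem_Gam {x : Vec m} (hx : x ≠ 0) : vec x ∈ Gam m :=
  Submonoid.subset_closure ⟨x, hx, rfl⟩

theorem bar_ne_zero {x : Vec m} (hx : x ≠ 0) : bar x ≠ 0 := by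
  rwa [← norm_ne_zero_iff, norm_bar, norm_ne_zero_iff]

theorem prime_mem_Gam {a : Cl m} (ha : a ∈ Gam m) : prime a ∈ Gam m := by
  induction ha using Submonoid.closure_induction with
  | mem a ha =>
    obtain ⟨x, hx, rfl⟩ := ha
    rw [prime_vec]; exact vec_mem_Gam (bar_ne_zero hx)
  | one => rw [prime, map_one]; exact one_mem _
  | mul a b _ _ ha hb => rw [prime, map_mul]; exact mul_mem ha hb

theorem rev_mem_Gam {a : Cl m} (ha : a ∈ Gam m) : rev a ∈ Gam m := by
  induction ha using Submonoid.closure_induction with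
  | mem a ha =>
    obtain ⟨x, hx, rfl⟩ := ha
    rw [rev_vec]; exact vec_mem_Gam hx
  | one => rw [rev, CliffordAlgebra.reverse.map_one]; exact one_mem _
  | mul a b _ _ ha hb => rw [rev_mul]; exact mul_mem hb ha

theorem smul_mem_Gam {a : Cl m} (ha : a ∈ Gam m) {r : ℝ} (hr : r ≠ 0) : r • a ∈ Gam m := by
  have h : vec (EuclideanSpace.single 0 r : Vec m) = algebraMap ℝ (Cl m) r := by
    have : (fun j : Fin m => (EuclideanSpace.single 0 r : Vec m) j.succ) = 0 := by
      funext j; simp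
    rw [vec, this, map_zero, add_zero]; simp
  rw [Algebra.smul_def, ← h]
  exact mul_mem (vec_mem_Gam (by simpa using hr)) ha

/-- For a product, the inner factor b b̄ is a scalar, hence central, and can be pulled out. This
identifies N with `cnorm a ^ 2` and gives inverses and multiplicativity of the norm on Γ. -/
theorem exists_mul_conj {a : Cl m} (ha : a ∈ Gam m) : ∃ N : ℝ, 0 < N ∧
    a * conj a = algebraMap ℝ (Cl m) N ∧ conj a * a = algebraMap ℝ (Cl m) N := by
  induction ha using Submonoid.closure_induction with
  | mem a ha =>
    obtain ⟨x, hx, rfl⟩ := ha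
    rw [conj_vec]
    exact ⟨‖x‖ ^ 2, by positivity, vec_mul_vec_bar x, vec_bar_mul_vec x⟩
  | one => exact ⟨1, one_pos, by rw [conj_one, map_one, one_mul], by rw [conj_one, map_one, one_mul]⟩
  | mul a b _ _ ha hb =>
    obtain ⟨N, hN, h1, h2⟩ := ha
    obtain ⟨K, hK, h3, h4⟩ := hb
    refine ⟨N * K, by positivity, ?_, ?_⟩
    · rw [conj_mul, mul_assoc, ← mul_assoc b, h3, Algebra.commutes, ← mul_assoc, h1, map_mul]
    · rw [conj_mul, mul_assoc, ← mul_assoc (conj a), h2, Algebra.commutes, ← mul_assoc, h4,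
        map_mul, Algebra.commutes]

theorem cnorm_sq_of_mul_conj {a : Cl m} {N : ℝ} (hN : 0 ≤ N)
    (h : a * conj a = algebraMap ℝ (Cl m) N) : cnorm a ^ 2 = N := by
  rw [cnorm, h, scalarPart_algebraMap, Real.sq_sqrt hN]

theorem mul_conj_self {a : Cl m} (ha : a ∈ Gam m) :
    a * conj a = algebraMap ℝ (Cl m) (cnorm a ^ 2) := by
  obtain ⟨N, hN, h1, -⟩ := exists_mul_conj ha
  rw [cnorm_sq_of_mul_conj hN.le h1, h1]

theorem conj_mul_self {a : Cl m} (ha : a ∈ Gam m) :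
    conj a * a = algebraMap ℝ (Cl m) (cnorm a ^ 2) := by
  obtain ⟨N, hN, h1, h2⟩ := exists_mul_conj ha
  rw [cnorm_sq_of_mul_conj hN.le h1, h2]

theorem cnorm_nonneg (a : Cl m) : 0 ≤ cnorm a := Real.sqrt_nonneg _

theorem cnorm_pos {a : Cl m} (ha : a ∈ Gam m) : 0 < cnorm a := by
  obtain ⟨N, hN, h1, -⟩ := exists_mul_conj ha
  have := cnorm_sq_of_mul_conj hN.le h1
  refine (cnorm_nonneg a).lt_of_ne fun h => ?_
  rw [← h] at this
  simp at this
  exact hN.ne this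

theorem cnorm_mul {a b : Cl m} (ha : a ∈ Gam m) (hb : b ∈ Gam m) :
    cnorm (a * b) = cnorm a * cnorm b := by
  have h : cnorm (a * b) ^ 2 = cnorm a ^ 2 * cnorm b ^ 2 := by
    refine cnorm_sq_of_mul_conj (by positivity) ?_
    rw [conj_mul, mul_assoc, ← mul_assoc b, mul_conj_self hb, Algebra.commutes, ← mul_assoc,
      mul_conj_self ha, map_mul]
  rw [← mul_pow] at h
  exact (sq_eq_sq₀ (cnorm_nonneg _) (mul_nonneg (cnorm_nonneg _) (cnorm_nonneg _))).1 h

theorem cnorm_one : cnorm (1 : Cl m) = 1 := by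
  have := cnorm_sq_of_mul_conj (m := m) (a := 1) zero_le_one
    (by rw [conj_one, map_one, one_mul])
  exact (sq_eq_sq₀ (cnorm_nonneg _) zero_le_one).1 (by rw [this, one_pow])

theorem cnorm_vec (x : Vec m) : cnorm (vec x) = ‖x‖ := by
  have := cnorm_sq_of_mul_conj (sq_nonneg ‖x‖) ((conj_vec x).symm ▸ vec_mul_vec_bar x)
  exact (sq_eq_sq₀ (cnorm_nonneg _) (norm_nonneg _)).1 this

/-- Every element of the Clifford group is invertible in the Clifford group. -/
theorem exists_inverse {a : Cl m} (ha : a ∈ Gam m) : ∃ c ∈ Gam m, a * c = 1 ∧ c * a = 1 ∧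
    conj a = cnorm a ^ 2 • c ∧ cnorm c = (cnorm a)⁻¹ := by
  have hp := cnorm_pos ha
  have hc : (cnorm a ^ 2)⁻¹ • conj a ∈ Gam m :=
    smul_mem_Gam (rev_mem_Gam (prime_mem_Gam ha)) (by positivity)
  have h1 : a * (cnorm a ^ 2)⁻¹ • conj a = 1 := by
    rw [mul_smul_comm, mul_conj_self ha, Algebra.algebraMap_eq_smul_one, smul_smul,
      inv_mul_cancel₀ (by positivity), one_smul]
  refine ⟨_, hc, h1, ?_, ?_, ?_⟩
  · rw [smul_mul_assoc, conj_mul_self ha, Algebra.algebraMap_eq_smul_one, smul_smul,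
      inv_mul_cancel₀ (by positivity), one_smul]
  · rw [smul_smul, mul_inv_cancel₀ (by positivity), one_smul]
  · rw [eq_comm, inv_eq_iff_eq_inv, eq_comm]
    refine inv_eq_of_mul_eq_one_left ?_
    rw [← cnorm_mul ha hc, h1, cnorm_one]

theorem ne_zero_of_mem_Gam {a : Cl m} (ha : a ∈ Gam m) : a ≠ 0 := by
  rintro rfl
  obtain ⟨c, -, h, -⟩ := exists_inverse ha
  rw [zero_mul] at h
  exact zero_ne_one h

theorem vec_mul_vec_bar_add (x y : Vec m) :
    vec x * vec (bar y) + vec y * vec (bar x) = algebraMap ℝ (Cl m) (2 * inner ℝ x y) := by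
  have h := vec_mul_vec_bar (x + y)
  rw [map_add, vec_add, vec_add, add_mul, mul_add, mul_add, vec_mul_vec_bar, vec_mul_vec_bar,
    norm_add_sq_real, map_add, map_add] at h
  rw [← sub_eq_zero] at h ⊢
  rw [← h]
  abel

/-- The twisted conjugation `x ↦ a^* x a` by an element of the Clifford group preserves the space
of vectors and is a similarity. -/
theorem exists_similarity {a : Cl m} (ha : a ∈ Gam m) : ∃ L : Vec m →ₗ[ℝ] Vec m,
    (∀ y, vec (L y) = rev a * vec y * a) ∧ ∀ y, ‖L y‖ = cnorm a ^ 2 * ‖y‖ := by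
  have hL : ∃ L : Vec m →ₗ[ℝ] Vec m, ∀ y, vec (L y) = rev a * vec y * a := by
    induction ha using Submonoid.closure_induction with
    | mem a ha =>
      obtain ⟨v, hv, rfl⟩ := ha
      -- v y v = 2(v, ȳ) v - |v|² ȳ, obtained from v y + ȳ v̄ = 2(v, ȳ) by multiplying with v on the
      -- right.
      refine ⟨(((2 : ℝ) • (innerSL ℝ v).toLinearMap).smulRight v).comp bar - ‖v‖ ^ 2 • bar,
        fun y => ?_⟩
      have h := vec_mul_vec_bar_add v (bar y)
      rw [bar_bar] at h
      rw [rev_vec, eq_sub_of_add_eq h, sub_mul, mul_assoc, vec_bar_mul_vec, ← Algebra.smul_def,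
        ← Algebra.commutes, ← Algebra.smul_def, ← vec_smul, ← vec_smul, ← vec_sub]
      rfl
    | one => exact ⟨LinearMap.id, fun y => by simp⟩
    | mul a b _ _ ha hb =>
      obtain ⟨L, hL⟩ := ha
      obtain ⟨K, hK⟩ := hb
      refine ⟨K.comp L, fun y => ?_⟩
      rw [LinearMap.comp_apply, hK, hL, rev_mul]
      simp only [mul_assoc]
  obtain ⟨L, hL⟩ := hL
  refine ⟨L, hL, fun y => ?_⟩
  have h1 : rev a * prime a = algebraMap ℝ (Cl m) (cnorm a ^ 2) := by
    have := congrArg prime (conj_mul_self ha)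
    rwa [prime_mul, prime_algebraMap, conj, rev_prime, prime_prime] at this
  have h2 : cnorm (vec (L y)) ^ 2 = (cnorm a ^ 2 * ‖y‖) ^ 2 := by
    refine cnorm_sq_of_mul_conj (sq_nonneg _) ?_
    have h3 : conj (rev a) = prime a := by rw [conj, rev_prime, rev_rev]
    rw [hL, conj_mul, conj_mul, h3, conj_vec]
    calc rev a * vec y * a * (conj a * (vec (bar y) * prime a))
        = rev a * vec y * (a * conj a) * (vec (bar y) * prime a) := by simp only [mul_assoc]
      _ = algebraMap ℝ (Cl m) (cnorm a ^ 2) * (rev a * (vec y * vec (bar y)) * prime a) := by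
          rw [mul_conj_self ha, ← Algebra.commutes]; simp only [mul_assoc]
      _ = _ := by
          rw [vec_mul_vec_bar, ← Algebra.commutes, mul_assoc, h1, ← map_mul, ← map_mul]
          ring_nf
  rw [cnorm_vec] at h2
  exact (sq_eq_sq₀ (norm_nonneg _) (by positivity)).1 h2

end Clifford

/-! ### The representation τ' and the normal forms of π'_λ(g) -/

section Spin

variable {m : ℕ} {S : Type*} [NormedAddCommGroup S] [InnerProductSpace ℂ S]
  [FiniteDimensional ℂ S] (M : CliffordModule m S)

theorem E_zero_E_zero (v : S) : M.E 0 (M.E 0 v) = -v := by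
  have h := cmul_cmul M (EuclideanSpace.single 0 1) v
  simpa [cmul_single] using h

theorem tau_vec (y : Vec m) (v : S) : tau M (vec y) v = -cmul M y (M.E 0 v) := by
  have h : ∀ j : Fin m, M.E 0 (M.E j.succ v) = -M.E j.succ (M.E 0 v) := fun j => by
    have := E_E_add M 0 j.succ v
    rw [if_neg (Fin.succ_ne_zero j).symm] at this
    exact eq_neg_of_add_eq_zero_left this
  rw [vec, map_add, AlgHom.commutes, tau, CliffordAlgebra.lift_ι_apply, cmul_apply,
    Fin.sum_univ_succ, E_zero_E_zero]
  simp [tauLin, h, Module.algebraMap_end_apply, add_comm]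

theorem tau'_mul (a b : Cl m) : tau' M (a * b) = tau' M a * tau' M b := by
  rw [tau', prime_mul, map_mul]; rfl

theorem tau'_one : tau' M (1 : Cl m) = 1 := by
  rw [tau', prime, map_one, map_one]

theorem tau'_smul (r : ℝ) (a : Cl m) : tau' M (r • a) = r • tau' M a := by
  rw [tau', prime, map_smul, map_smul]; rfl

theorem E_zero_tau'_vec (y : Vec m) (v : S) : M.E 0 (tau' M (vec y) v) = cmul M y v := by
  have h := cmul_cmul_add M (EuclideanSpace.single 0 1) y v
  rw [real_inner_comm, inner_single_right] at h
  rw [tau', prime_vec, tau_vec, bar]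
  simp only [LinearMap.coe_mk, AddHom.coe_mk, map_sub, map_smul, smul_apply, sub_apply, cmul_single,
    E_zero_E_zero, map_neg, LinearMap.map_smul_of_tower] at h ⊢
  have h2 := cmul_cmul_add M (EuclideanSpace.single 0 1) y (M.E 0 v)
  rw [real_inner_comm, inner_single_right, cmul_single, cmul_single, E_zero_E_zero, map_neg] at h2
  rw [← sub_eq_zero] at h2 ⊢
  rw [← h2]
  module

/-- For a vector y both sides are c(y), and the relation passes to products. -/
theorem E_zero_tau' {b : Cl m} (hb : b ∈ Gam m) (v : S) :
    M.E 0 (tau' M b v) = tau M b (M.E 0 v) := by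
  induction hb using Submonoid.closure_induction generalizing v with
  | mem b hb =>
    obtain ⟨y, -, rfl⟩ := hb
    rw [E_zero_tau'_vec, tau_vec, E_zero_E_zero, map_neg, neg_neg]
  | one => rw [tau'_one, map_one]; rfl
  | mul a b _ _ ha hb =>
    rw [tau'_mul, map_mul, Module.End.mul_apply, Module.End.mul_apply, ha, hb]

theorem tau_eq_tau'_prime (a : Cl m) : tau M a = tau' M (prime a) := by
  rw [tau', prime_prime]

theorem inverse_tau' {a c : Cl m} (h1 : a * c = 1) (h2 : c * a = 1) {r : ℝ} (hr : r ≠ 0) :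
    Ring.inverse (tau' M (r⁻¹ • a)) = r • tau' M c := by
  let u : (Module.End ℂ S)ˣ := ⟨tau' M (r⁻¹ • a), r • tau' M c, by
    rw [tau'_smul, smul_mul_smul_comm, inv_mul_cancel₀ hr, one_smul, ← tau'_mul, h1, tau'_one], by
    rw [tau'_smul, smul_mul_smul_comm, mul_inv_cancel₀ hr, one_smul, ← tau'_mul, h2, tau'_one]⟩
  exact Ring.inverse_unit u

theorem ring_inverse_eq {a c : Cl m} (h1 : a * c = 1) (h2 : c * a = 1) :
    Ring.inverse a = c := Ring.inverse_unit ⟨a, c, h1, h2⟩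

/-- The normal form of `π'_λ(g)` for `b = 0`: the action of a similarity. -/
theorem piPrime_of_b_eq_zero {g : Matrix (Fin 2) (Fin 2) (Cl m)} (hg : g ∈ SL2Gam m)
    (hb : g 0 1 = 0) : ∃ (β : ℝ) (L : Vec m →ₗ[ℝ] Vec m) (w : Vec m) (T : Module.End ℂ S),
      0 < β ∧ (∀ y, ‖L y‖ = (β ^ 2)⁻¹ * ‖y‖) ∧
      (∀ y v, cmul M y (T v) = β ^ 2 • T (cmul M (L y) v)) ∧ (∀ x, den g x ≠ 0) ∧
      (∀ x, act g x = L x + w) ∧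
      ∀ (l : ℂ) (f : Vec m → S), piPrime M l g f =
        fun x => ((β : ℂ) ^ (-2 * l - ((m + 1 : ℕ) : ℂ))) • T (f (L x + w)) := by
  obtain ⟨hGam, hdet, -, ⟨v1, hv1⟩⟩ := hg
  rw [hb, zero_mul, sub_zero] at hdet
  have hden : ∀ x, den g x = rev (g 1 1) := fun x => by simp [den, hb]
  have hd : g 1 1 ∈ Gam m := (hGam 1 1).resolve_right fun h => by
    rw [h, rev_zero, mul_zero] at hdet; exact zero_ne_one hdet
  have ha : g 0 0 ∈ Gam m := (hGam 0 0).resolve_right fun h => by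
    rw [h, zero_mul] at hdet; exact zero_ne_one hdet
  set a := g 0 0 with haa
  set δ := rev (g 1 1) with hδδ
  have hδ : δ ∈ Gam m := rev_mem_Gam hd
  obtain ⟨a', -, hδa', ha'δ, hconj, hcn⟩ := exists_inverse hδ
  -- For b = 0 the determinant condition says a = (d^*)^{-1}.
  have haa' : a = a' := by
    rw [← mul_one a, ← hδa', ← mul_assoc, hdet, one_mul]
  rw [← haa'] at hδa' ha'δ hconj hcn
  obtain ⟨L, hL, hLn⟩ := exists_similarity ha
  have hβ := cnorm_pos hδ
  have hrev : rev δ * rev a = 1 := by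
    rw [← rev_mul, hdet, rev, CliffordAlgebra.reverse.map_one]
  have hact : ∀ x, act g x = L x + -L v1 := by
    intro x
    -- c = (c d^*) a with c d^* = v1, so the action is x ↦ a^*(x - v1)a.
    have hc : g 1 0 = vec v1 * a := by rw [hv1, mul_assoc, hδa', mul_one]
    rw [act, hden, ring_inverse_eq hδa' ha'δ, hc, rev_mul, rev_vec, add_mul, neg_mul, ← hL, ← hL,
      ← vec_neg, ← vec_add, ofVec_vec, add_comm]
  refine ⟨cnorm δ, L, -L v1, cnorm δ • tau' M a, hβ, ?_, ?_, ?_, hact, ?_⟩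
  · intro y; rw [hLn, hcn, inv_pow]
  · intro y v
    -- Since δ^* a^* = 1. Applying E_1 τ' and moving E_1 past τ'(δ^*) leaves τ(δ^*) = τ'(δ̄), and δ̄
    -- = β² a supplies μ = β².
    have h1 : vec y * a = rev δ * vec (L y) := by
      rw [hL, ← mul_assoc, ← mul_assoc, hrev, one_mul]
    have h2 : cmul M y (tau' M a v) = cnorm δ ^ 2 • tau' M a (cmul M (L y) v) := by
      rw [← E_zero_tau'_vec, ← Module.End.mul_apply (tau' M (vec y)), ← tau'_mul, h1, tau'_mul,
        Module.End.mul_apply, E_zero_tau' M (rev_mem_Gam hδ), E_zero_tau'_vec, tau_eq_tau'_prime,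
        ← rev_prime]
      change tau' M (conj δ) _ = _
      rw [hconj, tau'_smul, LinearMap.smul_apply]
    rw [LinearMap.smul_apply, LinearMap.smul_apply, map_smul, h2, smul_comm]
  · intro x; rw [hden]; exact ne_zero_of_mem_Gam hδ
  · intro l f
    funext x
    rw [piPrime, if_neg (by rw [hden]; exact ne_zero_of_mem_Gam hδ), piFormula, hact, hden,
      inverse_tau' M hδa' ha'δ hβ.ne']

/-- The normal form of `π'_λ(g)` for `b ≠ 0`: a Kelvin transform composed with a similarity and
a translation. -/
theorem piFormula_of_b_ne_zero {g : Matrix (Fin 2) (Fin 2) (Cl m)} (hg : g ∈ SL2Gam m)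
    (hb : g 0 1 ≠ 0) : ∃ (β : ℝ) (L : Vec m →ₗ[ℝ] Vec m) (p w : Vec m) (T : Module.End ℂ S),
      0 < β ∧ (∀ y, ‖L y‖ = (β ^ 2)⁻¹ * ‖y‖) ∧
      (∀ y v, cmul M y (T v) = (-β ^ 2) • T (cmul M (L y) v)) ∧ (∀ x, den g x = 0 ↔ x = p) ∧
      (∀ x, x ≠ p → act g x = L (inversion (x - p)) + w) ∧
      ∀ (l : ℂ) (f : Vec m → S) (x : Vec m), x ≠ p → piFormula M l g f x =
        (((β * ‖x - p‖ : ℝ) : ℂ) ^ (-2 * l - ((m + 1 : ℕ) : ℂ))) • ‖x - p‖⁻¹ •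
          cmul M (x - p) (T (f (L (inversion (x - p)) + w))) := by
  obtain ⟨hGam, hdet, ⟨v0, hv0⟩, ⟨v1, hv1⟩⟩ := hg
  have hbG : g 0 1 ∈ Gam m := (hGam 0 1).resolve_right hb
  set B := rev (g 0 1) with hBB
  have hbB : g 0 1 = rev B := by rw [hBB, rev_rev]
  have hB : B ∈ Gam m := rev_mem_Gam hbG
  obtain ⟨C, hC, hBC, hCB, hconj, hcn⟩ := exists_inverse hB
  have hβ := cnorm_pos hB
  obtain ⟨K, hK, hKn⟩ := exists_similarity hC
  have hrev1 : rev B * rev C = 1 := by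
    rw [← rev_mul, hCB, rev, CliffordAlgebra.reverse.map_one]
  have hrev2 : rev C * rev B = 1 := by
    rw [← rev_mul, hBC, rev, CliffordAlgebra.reverse.map_one]
  set a := g 0 0 with haa
  set c := g 1 0 with hcc
  set δ := rev (g 1 1) with hδδ
  have hdδ : g 1 1 = rev δ := by rw [hδδ, rev_rev]
  rw [hbB] at hdet
  have haC : a = vec v0 * C := by rw [hv0, mul_assoc, hBC, mul_one]
  -- The vector b^{-1}a; its negative is the translation part w of the action.
  have hw : vec (K v0) = rev C * a := by rw [hK, haC, mul_assoc]
  have hra : rev a = vec (K v0) * B := by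
    have : a = rev B * vec (K v0) := by rw [hw, ← mul_assoc, hrev1, one_mul]
    rw [this, rev_mul, rev_vec, rev_rev]
  have hrc : rev c = vec (K v0) * δ - rev C := by
    have : rev C * (a * δ - rev B * rev c) = rev C := by rw [hdet, mul_one]
    rw [mul_sub, ← mul_assoc, ← mul_assoc, hrev2, one_mul, ← hw] at this
    rw [← this]; abel
  -- The zero of u = d^* - b^*x is (b^*)^{-1}d^*. It is a vector because c d^* = δ^*(b^{-1}a)δ - Cδ,
  -- where the left side is a vector by hypothesis and δ^*(b^{-1}a)δ by twisted conjugation (or d =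
  -- 0).
  have hp : ∃ p, vec p = C * δ := by
    have h1 : ∃ z, vec z = rev δ * vec (K v0) * δ := by
      rcases hGam 1 1 with h | h
      · obtain ⟨D, hD, -⟩ := exists_similarity (rev_mem_Gam h)
        exact ⟨D (K v0), hD _⟩
      · refine ⟨0, ?_⟩
        rw [hδδ, h, rev_zero, mul_zero, vec_zero]
    obtain ⟨z, hz⟩ := h1
    refine ⟨z - v1, ?_⟩
    have h2 : c = rev δ * vec (K v0) - C := by
      rw [← rev_rev c, hrc, rev_sub, rev_mul, rev_vec, rev_rev C]
    rw [vec_sub, hz, hv1, h2, sub_mul]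
    abel
  obtain ⟨p, hp⟩ := hp
  have hden : ∀ x, den g x = -(B * vec (x - p)) := by
    intro x
    rw [den, vec_sub, hp, mul_sub, ← mul_assoc, hBC, one_mul, neg_sub]
  have hq : ∀ {z : Vec m}, z ≠ 0 → vec (inversion z) = (‖z‖ ^ 2)⁻¹ • vec z := by
    intro z _
    rw [inversion, vec_smul, qpow, Real.rpow_neg_one]
  have hinv : ∀ x, x ≠ p → den g x * -(vec (bar (inversion (x - p))) * C) = 1 ∧
      -(vec (bar (inversion (x - p))) * C) * den g x = 1 := by
    intro x hx
    have hz := sub_ne_zero.2 hx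
    have hn : (‖x - p‖ ^ 2)⁻¹ * ‖x - p‖ ^ 2 = 1 := inv_mul_cancel₀ (by positivity)
    have h1 : vec (x - p) * vec (bar (inversion (x - p))) = 1 := by
      rw [← prime_vec, hq hz, prime, map_smul, ← prime, prime_vec, mul_smul_comm, vec_mul_vec_bar,
        Algebra.algebraMap_eq_smul_one, smul_smul, hn, one_smul]
    have h2 : vec (bar (inversion (x - p))) * vec (x - p) = 1 := by
      rw [← prime_vec, hq hz, prime, map_smul, ← prime, prime_vec, smul_mul_assoc, vec_bar_mul_vec,
        Algebra.algebraMap_eq_smul_one, smul_smul, hn, one_smul]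
    rw [hden, neg_mul_neg, neg_mul_neg]
    constructor
    · rw [mul_assoc, ← mul_assoc (vec (x - p)), h1, one_mul, hBC]
    · rw [mul_assoc, ← mul_assoc C, hCB, one_mul, h2]
  have hact : ∀ x, x ≠ p → act g x = (-(K.comp bar)) (inversion (x - p)) + -K v0 := by
    intro x hx
    obtain ⟨h1, h2⟩ := hinv x hx
    -- Division with remainder by u: the action becomes C^* u^{-1} - K v0, with u^{-1} = -(x -
    -- p)^{-1} C.
    have h3 : -rev c + rev a * vec x = rev C - vec (K v0) * den g x := by
      rw [hrc, hra, den, mul_sub, mul_assoc]; abel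
    rw [act, ring_inverse_eq h1 h2, h3, sub_mul, mul_assoc (vec (K v0)), h1, mul_one, mul_neg,
      ← mul_assoc, ← hK, ← vec_neg, ← vec_sub, ofVec_vec, sub_eq_add_neg]
    rfl
  -- The E_1 in T appears because τ'(z̄) = τ(z) = -c(z)E_1 for a vector z; the minus sign cancels
  -- that of u^{-1}. The factor β undoes the normalization u/|u|.
  refine ⟨cnorm B, -(K.comp bar), p, -K v0, cnorm B • (M.E 0 * tau' M C), hβ, ?_, ?_, ?_, hact, ?_⟩
  · intro y
    rw [LinearMap.neg_apply, norm_neg, LinearMap.comp_apply, hKn, norm_bar, hcn, inv_pow]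
  · intro y v
    have h1 : vec (bar y) * C = -(rev B * vec ((-(K.comp bar)) y)) := by
      rw [LinearMap.neg_apply, vec_neg, mul_neg, neg_neg, LinearMap.comp_apply, hK, ← mul_assoc,
        ← mul_assoc, hrev1, one_mul]
    set Ly := (-(K.comp bar)) y with hLy
    have hE : ∀ u, tau' M (vec Ly) u = -M.E 0 (cmul M Ly u) := fun u => by
      rw [← E_zero_tau'_vec, E_zero_E_zero, neg_neg]
    have h2 : cmul M y (M.E 0 (tau' M C v)) =
        (-cnorm B ^ 2) • M.E 0 (tau' M C (cmul M Ly v)) := by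
      calc cmul M y (M.E 0 (tau' M C v)) = -tau M (vec y) (tau' M C v) := by
            rw [tau_vec, neg_neg]
        _ = -tau' M (vec (bar y) * C) v := by
            rw [tau'_mul, tau_eq_tau'_prime, prime_vec]; rfl
        _ = tau' M (rev B) (tau' M (vec Ly) v) := by
            rw [h1, ← neg_one_smul ℝ (rev B * vec Ly), tau'_smul, tau'_mul, neg_one_smul,
              LinearMap.neg_apply, neg_neg]
            rfl
        _ = -tau M (prime (rev B)) (M.E 0 (cmul M Ly v)) := by
            rw [hE, map_neg]; rfl
        _ = -M.E 0 (tau' M (conj B) (cmul M Ly v)) := by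
            rw [← rev_prime, E_zero_tau' M (rev_mem_Gam (prime_mem_Gam hB))]
        _ = _ := by
            rw [hconj, tau'_smul, LinearMap.smul_apply, LinearMap.map_smul_of_tower, neg_smul]
    simp only [LinearMap.smul_apply, map_smul, Module.End.mul_apply, h2]
    rw [smul_comm]
  · intro x
    rw [hden, neg_eq_zero]
    constructor
    · intro h
      by_contra hx
      exact ne_zero_of_mem_Gam (mul_mem hB (vec_mem_Gam (sub_ne_zero.2 hx))) h
    · rintro rfl
      rw [sub_self, vec_zero, mul_zero]
  · intro l f x hx
    obtain ⟨h1, h2⟩ := hinv x hx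
    have hz := sub_ne_zero.2 hx
    have hr : 0 < ‖x - p‖ := norm_pos_iff.2 hz
    have hcd : cnorm (den g x) = cnorm B * ‖x - p‖ := by
      rw [hden, ← mul_neg, ← vec_neg, cnorm_mul hB (vec_mem_Gam (neg_ne_zero.2 hz)), cnorm_vec,
        norm_neg]
    rw [piFormula, hcd, inverse_tau' M h1 h2 (by positivity), hact x hx]
    congr 1
    set F := f ((-(K.comp bar)) (inversion (x - p)) + -K v0)
    have h3 : tau' M (-(vec (bar (inversion (x - p))) * C)) F =
        (‖x - p‖ ^ 2)⁻¹ • cmul M (x - p) (M.E 0 (tau' M C F)) := by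
      rw [← neg_one_smul ℝ (vec (bar (inversion (x - p))) * C), tau'_smul, tau'_mul, tau',
        ← prime_vec, prime_prime, hq hz, map_smul, neg_one_smul, LinearMap.neg_apply,
        Module.End.mul_apply, LinearMap.smul_apply, tau_vec, smul_neg, neg_neg]
    rw [LinearMap.smul_apply, h3, LinearMap.smul_apply, map_smul, smul_smul, smul_smul,
      Module.End.mul_apply]
    congr 1
    field_simp

end Spin

/-! ### Bookkeeping of powers, and the local and global intertwining identities -/

section Intertwining

variable {m : ℕ} {S : Type*} [NormedAddCommGroup S] [InnerProductSpace ℂ S]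
  [FiniteDimensional ℂ S] (M : CliffordModule m S)

omit [FiniteDimensional ℂ S] in
theorem cpow_smul_source (k : ℕ) {t : ℝ} (ht : 0 ≤ t) (v : S) :
    ((t : ℂ) ^ (-2 * (-(k : ℂ) - 1 / 2) - ((m + 1 : ℕ) : ℂ))) • v =
      (t ^ (2 * (k : ℝ) - m)) • v := by
  rw [← Complex.coe_smul, Complex.ofReal_cpow ht]
  congr 2
  push_cast; ring

omit [FiniteDimensional ℂ S] in
theorem cpow_smul_target (k : ℕ) {t : ℝ} (ht : 0 ≤ t) (v : S) :
    ((t : ℂ) ^ (-2 * ((k : ℂ) + 1 / 2) - ((m + 1 : ℕ) : ℂ))) • v =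
      (t ^ (-2 * (k : ℝ) - 2 - m)) • v := by
  rw [← Complex.coe_smul, Complex.ofReal_cpow ht]
  congr 2
  push_cast; ring

/-- Each D contributes |μ|ρ² = β^{-2}, and 2k + 1 of them take the source exponent to the target
exponent. -/
theorem rpow_source_mul (k : ℕ) {β : ℝ} (hβ : 0 < β) :
    β ^ (2 * (k : ℝ) - m) * ((β ^ 2)⁻¹) ^ (2 * k + 1) = β ^ (-2 * (k : ℝ) - 2 - m) := by
  rw [← inv_pow, ← pow_mul, inv_pow, ← Real.rpow_natCast, ← Real.rpow_neg hβ.le,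
    ← Real.rpow_add hβ]
  congr 1
  push_cast; ring

theorem qpow_eq_rpow (p : ℝ) (x : Vec m) : qpow p x = ‖x‖ ^ (2 * p) := by
  rw [qpow, ← Real.rpow_natCast, ← Real.rpow_mul (norm_nonneg _)]
  norm_num

/-- Matches |u|^t, |u| = β|z|, with the Kelvin weight; the extra |z|^{-1} comes from normalizing
c(z). -/
theorem rpow_mul_norm (t p : ℝ) {β : ℝ} (hβ : 0 < β) {z : Vec m} (hz : z ≠ 0)
    (h : t - 1 = 2 * p) : (β * ‖z‖) ^ t * ‖z‖⁻¹ = β ^ t * qpow p z := by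
  have hr : 0 < ‖z‖ := norm_pos_iff.2 hz
  rw [qpow_eq_rpow, ← h, Real.mul_rpow hβ.le hr.le, Real.rpow_sub_one hr.ne', mul_assoc,
    div_eq_mul_inv]

theorem piPrime_of_den_ne_zero (l : ℂ) {g : Matrix (Fin 2) (Fin 2) (Cl m)} (f : Vec m → S)
    {x : Vec m} (hx : den g x ≠ 0) : piPrime M l g f x = piFormula M l g f x := if_neg hx

theorem contDiff_comp_similarity (T : Module.End ℂ S) (L : Vec m →ₗ[ℝ] Vec m) (w : Vec m)
    {f : Vec m → S} (hf : ContDiff ℝ ∞ f) : ContDiff ℝ ∞ fun y => T (f (L y + w)) :=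
  ((LinearMap.toContinuousLinearMap T).restrictScalars ℝ).contDiff.comp
    (hf.comp ((LinearMap.toContinuousLinearMap L).contDiff.add contDiff_const))

include M in
theorem isOpen_den_ne_zero {g : Matrix (Fin 2) (Fin 2) (Cl m)} (hg : g ∈ SL2Gam m) :
    IsOpen {x | den g x ≠ 0} := by
  by_cases hb : g 0 1 = 0
  · obtain ⟨-, -, -, -, -, -, -, hden, -⟩ := piPrime_of_b_eq_zero M hg hb
    simp [hden]
  · obtain ⟨-, -, p, -, -, -, -, -, hden, -⟩ := piFormula_of_b_ne_zero M hg hb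
    simp only [ne_eq, hden]
    exact isOpen_ne

include M in
theorem continuousAt_act {g : Matrix (Fin 2) (Fin 2) (Cl m)} (hg : g ∈ SL2Gam m) {x : Vec m}
    (hx : den g x ≠ 0) : ContinuousAt (act g) x := by
  by_cases hb : g 0 1 = 0
  · obtain ⟨-, L, w, -, -, -, -, -, hact, -⟩ := piPrime_of_b_eq_zero M hg hb
    rw [show act g = fun x => L x + w from funext hact]
    exact ((LinearMap.toContinuousLinearMap L).continuous.add continuous_const).continuousAt
  · obtain ⟨-, L, p, w, -, -, -, -, hden, hact, -⟩ := piFormula_of_b_ne_zero M hg hb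
    rw [ne_eq, hden] at hx
    have h : act g =ᶠ[𝓝 x] fun x => L (inversion (x - p)) + w :=
      Filter.eventually_of_mem (isOpen_ne.mem_nhds hx) hact
    refine ContinuousAt.congr ?_ h.symm
    have h2 : ContinuousAt (fun x => inversion (x - p)) x :=
      ContinuousAt.comp (f := fun x => x - p) (contDiffAt_inversion (sub_ne_zero.2 hx)).continuousAt
        (continuous_id.sub continuous_const).continuousAt
    exact ((LinearMap.toContinuousLinearMap L).continuous.continuousAt.comp h2).add
      continuousAt_const

/-- The local intertwining property for functions that are smooth everywhere. -/
theorem dirac_iterate_piPrime_of_contDiff (k : ℕ) {g : Matrix (Fin 2) (Fin 2) (Cl m)}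
    (hg : g ∈ SL2Gam m) {f : Vec m → S} (hf : ContDiff ℝ ∞ f) {x : Vec m} (hx : den g x ≠ 0) :
    (dirac M)^[2 * k + 1] (piPrime M (-(k : ℂ) - 1 / 2) g f) x =
      piFormula M ((k : ℂ) + 1 / 2) g ((dirac M)^[2 * k + 1] f) x := by
  by_cases hb : g 0 1 = 0
  · obtain ⟨β, L, w, T, hβ, hL, hT, -, -, hpi⟩ := piPrime_of_b_eq_zero M hg hb
    have hρ : 0 < (β ^ 2)⁻¹ := by positivity
    rw [← piPrime_of_den_ne_zero M _ _ hx, hpi, hpi]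
    simp only [cpow_smul_source k hβ.le, cpow_smul_target k hβ.le]
    rw [dirac_iterate_const_smul M _ (contDiff_comp_similarity T L w hf),
      dirac_iterate_comp_similarity M hρ hL hT w hf]
    beta_reduce
    rw [smul_smul, ← rpow_source_mul k hβ]
    congr 3
    field_simp
  · obtain ⟨β, L, p, w, T, hβ, hL, hT, hden, -, hpi⟩ := piFormula_of_b_ne_zero M hg hb
    have hρ : 0 < (β ^ 2)⁻¹ := by positivity
    have hxp : x ≠ p := fun h => hx ((hden x).2 h)
    have hz := sub_ne_zero.2 hxp
    set F : Vec m → S := fun y => T (f (L y + w)) with hF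
    have hFs : ContDiff ℝ ∞ F := contDiff_comp_similarity T L w hf
    set s : ℝ := β ^ (2 * (k : ℝ) - m) with hs
    have h1 : piPrime M (-(k : ℂ) - 1 / 2) g f =ᶠ[𝓝 x]
        fun y => kelvin M (k - ((m : ℝ) + 1) / 2) (fun y => s • F y) (y - p) := by
      refine Filter.eventually_of_mem (isOpen_ne.mem_nhds hxp) fun y hy => ?_
      have hy0 := sub_ne_zero.2 hy
      beta_reduce
      rw [piPrime_of_den_ne_zero M _ _ fun h => hy ((hden y).1 h), hpi _ _ _ hy,
        cpow_smul_source k (by positivity), smul_smul,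
        rpow_mul_norm _ (k - ((m : ℝ) + 1) / 2) hβ hy0 (by ring), kelvin, map_smul, smul_smul,
        mul_comm]
    rw [(dirac_iterate_congr M h1 _).eq_of_nhds, dirac_iterate_comp_sub]
    beta_reduce
    rw [dirac_iterate_kelvin M k (hFs.const_smul s) hz, dirac_iterate_const_smul M s hFs,
      dirac_iterate_comp_similarity M hρ hL hT w hf, hpi _ _ _ hxp,
      cpow_smul_target k (by positivity), smul_smul,
      rpow_mul_norm _ (-k - 1 - ((m : ℝ) + 1) / 2) hβ hz (by ring), kelvin, smul_smul, map_smul,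
      smul_smul, ← neg_smul, ← rpow_source_mul k hβ]
    congr 1
    -- μ = -β² here, and the odd power 2k + 1 keeps the sign, cancelling the minus of the Kelvin
    -- identity.
    have h2 : -β ^ 2 * (β ^ 2)⁻¹ ^ 2 = -(β ^ 2)⁻¹ := by field_simp
    rw [h2, Odd.neg_pow ⟨k, rfl⟩]
    ring

omit [FiniteDimensional ℂ S] in
theorem exists_contDiff_eventuallyEq {U : Set (Vec m)} (hU : IsOpen U) {f : Vec m → S}
    (hf : ContDiffOn ℝ ∞ f U) {y : Vec m} (hy : y ∈ U) :
    ∃ F : Vec m → S, ContDiff ℝ ∞ F ∧ F =ᶠ[𝓝 y] f := by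
  obtain ⟨r, hr, hrU⟩ := Metric.isOpen_iff.1 hU y hy
  let χ : ContDiffBump y := ⟨r / 4, r / 2, by positivity, by linarith⟩
  refine ⟨fun x => χ x • f x, ?_, ?_⟩
  · refine contDiff_iff_contDiffAt.2 fun x => ?_
    by_cases hx : x ∈ tsupport χ
    · rw [χ.tsupport_eq] at hx
      have hxU : x ∈ U := hrU (Metric.closedBall_subset_ball (by simp only [χ]; linarith) hx)
      exact χ.contDiff.contDiffAt.smul (hf.contDiffAt (hU.mem_nhds hxU))
    · refine (contDiffAt_const (c := (0 : S))).congr_of_eventuallyEq ?_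
      filter_upwards [notMem_tsupport_iff_eventuallyEq.1 hx] with z hz
      rw [hz, Pi.zero_apply, zero_smul]
  · filter_upwards [χ.eventuallyEq_one] with x hx
    rw [hx, Pi.one_apply, one_smul]

theorem piFormula_congr (l : ℂ) (g : Matrix (Fin 2) (Fin 2) (Cl m)) {f F : Vec m → S}
    {x : Vec m} (h : F (act g x) = f (act g x)) : piFormula M l g F x = piFormula M l g f x := by
  rw [piFormula, piFormula, h]

/-- The local intertwining property. -/
theorem dirac_iterate_piPrime (k : ℕ) {g : Matrix (Fin 2) (Fin 2) (Cl m)} (hg : g ∈ SL2Gam m)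
    {U : Set (Vec m)} {f : Vec m → S} {x : Vec m} (hU : IsOpen U) (hf : ContDiffOn ℝ ∞ f U)
    (hx : den g x ≠ 0) (hxU : act g x ∈ U) :
    (dirac M)^[2 * k + 1] (piPrime M (-(k : ℂ) - 1 / 2) g f) x =
      piFormula M ((k : ℂ) + 1 / 2) g ((dirac M)^[2 * k + 1] f) x := by
  obtain ⟨F, hF, hFf⟩ := exists_contDiff_eventuallyEq hU hf hxU
  -- F and f agree near the image point, so by continuity of the action their transforms agree near
  -- x, and D is local.
  have h1 : piPrime M (-(k : ℂ) - 1 / 2) g F =ᶠ[𝓝 x] piPrime M (-(k : ℂ) - 1 / 2) g f := by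
    filter_upwards [(continuousAt_act M hg hx).eventually hFf,
      (isOpen_den_ne_zero M hg).mem_nhds hx] with y hy hy0
    rw [piPrime_of_den_ne_zero M _ _ hy0, piPrime_of_den_ne_zero M _ _ hy0,
      piFormula_congr M _ g hy]
  rw [← (dirac_iterate_congr M h1 _).eq_of_nhds, dirac_iterate_piPrime_of_contDiff M k hg hF hx]
  exact piFormula_congr M _ g (dirac_iterate_congr M hFf _).eq_of_nhds

/-- The global intertwining property, including the singular point. -/
theorem dirac_iterate_piPrime_eq (k : ℕ) {g : Matrix (Fin 2) (Fin 2) (Cl m)} (hg : g ∈ SL2Gam m)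
    {f : Vec m → S} (hf : ContDiff ℝ ∞ f)
    (hgf : ContDiff ℝ ∞ (piPrime M (-(k : ℂ) - 1 / 2) g f)) :
    (dirac M)^[2 * k + 1] (piPrime M (-(k : ℂ) - 1 / 2) g f) =
      piPrime M ((k : ℂ) + 1 / 2) g ((dirac M)^[2 * k + 1] f) := by
  have hloc : ∀ x, den g x ≠ 0 → (dirac M)^[2 * k + 1] (piPrime M (-(k : ℂ) - 1 / 2) g f) x =
      piFormula M ((k : ℂ) + 1 / 2) g ((dirac M)^[2 * k + 1] f) x := fun x hx =>
    dirac_iterate_piPrime M k hg isOpen_univ hf.contDiffOn hx (Set.mem_univ _)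
  funext x
  by_cases hx : den g x = 0
  · have hb : g 0 1 ≠ 0 := fun hb => by
      obtain ⟨-, -, -, -, -, -, -, hden, -⟩ := piPrime_of_b_eq_zero M hg hb
      exact hden x hx
    obtain ⟨-, -, p, -, -, -, -, -, hden, -⟩ := piFormula_of_b_ne_zero M hg hb
    have hxp := (hden x).1 hx
    have hc := (contDiff_dirac_iterate M hgf (2 * k + 1)).continuous.continuousAt (x := x)
    -- Away from the single zero of u the formula equals a function continuous at x, so the limit
    -- defining the extension exists and is its value.
    have ht : Filter.Tendsto (piFormula M ((k : ℂ) + 1 / 2) g ((dirac M)^[2 * k + 1] f)) (𝓝[≠] x)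
        (𝓝 ((dirac M)^[2 * k + 1] (piPrime M (-(k : ℂ) - 1 / 2) g f) x)) := by
      refine (hc.tendsto.mono_left nhdsWithin_le_nhds).congr' ?_
      filter_upwards [self_mem_nhdsWithin] with y hy
      exact hloc y fun h => hy (((hden y).1 h).trans hxp.symm)
    rw [piPrime, if_pos hx, ht.limUnder_eq]
  · rw [hloc x hx, piPrime_of_den_ne_zero M _ _ hx]

end Intertwining

end Vahlen

theorem mainTheorem1 (m : ℕ) {S : Type*} [NormedAddCommGroup S] [InnerProductSpace ℂ S]
    [FiniteDimensional ℂ S] (M : Vahlen.CliffordModule m S) (k : ℕ)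
    (g : Matrix (Fin 2) (Fin 2) (Vahlen.Cl m)) (hg : g ∈ Vahlen.SL2Gam m) :
    (∀ f ∈ Vahlen.smoothVectors M (-(k : ℂ) - 1 / 2),
      (Vahlen.dirac M)^[2 * k + 1] f ∈ Vahlen.smoothVectors M ((k : ℂ) + 1 / 2) ∧
      (Vahlen.dirac M)^[2 * k + 1] (Vahlen.piPrime M (-(k : ℂ) - 1 / 2) g f) =
        Vahlen.piPrime M ((k : ℂ) + 1 / 2) g ((Vahlen.dirac M)^[2 * k + 1] f)) ∧
    (∀ (U : Set (Vahlen.Vec m)) (f : Vahlen.Vec m → S) (x : Vahlen.Vec m),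
      IsOpen U → ContDiffOn ℝ ∞ f U → Vahlen.den g x ≠ 0 → Vahlen.act g x ∈ U →
      (Vahlen.dirac M)^[2 * k + 1] (Vahlen.piPrime M (-(k : ℂ) - 1 / 2) g f) x =
        Vahlen.piPrime M ((k : ℂ) + 1 / 2) g ((Vahlen.dirac M)^[2 * k + 1] f) x) := by
  refine ⟨fun f hf => ⟨⟨Vahlen.contDiff_dirac_iterate M hf.1 _, fun g' hg' => ?_⟩,
    Vahlen.dirac_iterate_piPrime_eq M k hg hf.1 (hf.2 g hg)⟩, fun U f x hU hf hx hxU => ?_⟩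
  -- Each translate of D^{2k+1}f is D^{2k+1} of a translate of f, hence smooth.
  · rw [← Vahlen.dirac_iterate_piPrime_eq M k hg' hf.1 (hf.2 g' hg')]
    exact Vahlen.contDiff_dirac_iterate M (hf.2 g' hg') _
  · rw [Vahlen.piPrime_of_den_ne_zero M _ _ hx]
    exact Vahlen.dirac_iterate_piPrime M k hg hU hf hx hxU
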